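/- Let $n\ge 0$, $K=\lfloor n/2\rfloor$, and let $m_1,\dots,m_n>0$. Put $k'=n+1-k$ and $e_j=1/m_{j'}^2$. *Spectral data.* Call $(\zeta_1,\dots,\zeta_K;\,b_1,\dots,b_K;\,c)$ admissible if $0<\zeta_1<\dots<\zeta_K$, all $b_j>0$, $c=0$ if $n$ is even and $c>0$ if $n$ is odd. For $x=(x_1,\dots,x_n)\in\mathbb R^n$ and $z\in\mathbb C$ let $q_0=0$, $p_0=1$, $q_k-q_{k-1}=m_ke^{x_k}p_{k-1}$, $p_k-p_{k-1}=-z\,m_ke^{-x_k}q_{k-1}$ $(1\le k\le n)$. We say that $(m,x)$ has spectral data $(\zeta;b;c)$ if the zeros of $p_n(z)$ are exactly the $\zeta_j$, and $\frac{q_n(z)}{p_n(z)}=c+\sum_{j=1}^K\frac{b_j}{\zeta_j-z}$ at all other $z$. *Inverse formulas.* For $y>0$ let $\hat\mu_c(y)=c+\sum_{j=1}^K\frac{b_j}{y+\zeta_j}$, and let $\mathcal D_k^{(l,p)}$ be the absolute value of the determinant of the $k\times k$ matrix whose $i$-th row is $\big(e_i^{p}\hat\mu_c(e_i),\,e_i^{p+1}\hat\mu_c(e_i),\dots,e_i^{p+l-1}\hat\mu_c(e_i),\,1,\,e_i,\dots,e_i^{k-l-1}\big)$,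 with $\mathcal D_0^{(l,p)}=1$. For distinct masses and $1\le k\le n$ set $$x_{k'}=\ln\frac{\big(\prod_{j=1}^{k-1}e_j\big)\,\mathcal D_k^{(\frac{k+1}2,0)}\mathcal D_{k-1}^{(\frac{k-1}2,0)}}{m_{k'}\,\mathcal D_k^{(\frac{k-1}2,1)}\mathcal D_{k-1}^{(\frac{k-1}2,1)}}\ (k\text{ odd}),\qquad x_{k'}=\ln\frac{\big(\prod_{j=1}^{k-1}e_j\big)\,\mathcal D_k^{(\frac k2,0)}\mathcal D_{k-1}^{(\frac k2,0)}}{m_{k'}\,\mathcal D_k^{(\frac k2,1)}\mathcal D_{k-1}^{(\frac k2-1,1)}}\ (k\text{ even}),\qquad(*)$$ and for general positive masses let $x_{k'}$ be the limit of $(*)$ as the mass vector is approached by vectors of distinct positive masses. *Regularized equation.* For a function $f$ on $\mathbb R$ with one-sided limits, $\langle f\rangle(y)=\frac12(f(y-)+f(y+))$. A function $u(x,t)$ solves $$m_t+\big((u^2-\langle u_x^2\rangle)m\big)_x=0,\qquad m=u-u_{xx},\qquad(\mathrm{mCH})$$ on an open set $I$ of times if for each $t\in I$: $u(\cdot,t)$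 is continuous, $u_x(\cdot,t)$ has one-sided limits at every point, $u-u_{xx}$ is (as a distribution in $x$) a locally finite positive measure $m(t)$, and for every $\varphi\in C_c^\infty(\mathbb R)$ the function $(u^2-\langle u_x^2\rangle)\varphi'$ is $m(t)$-integrable and $\frac{d}{dt}\int\varphi\,dm(t)=\int(u^2-\langle u_x^2\rangle)\,\varphi'\,dm(t)$. **Theorem.** (1) Let $(\zeta;b(0);c)$ be admissible, put $b_j(t)=b_j(0)e^{2t/\zeta_j}$, and let $x_1(t),\dots,x_n(t)$ be given by the inverse formulas with the data $(\zeta;b(t);c)$. Then: (a) the formulas are well defined for all $t\in\mathbb R$: for distinct masses the arguments of the logarithms in $(*)$ are (nonzero-denominator) positive numbers, and for general positive masses the limit defining $x_{k'}(t)$ exists; (b) for every $t$, $(m,x(t))$ has spectral data $(\zeta;b(t);c)$; (c) the set $I$ of times $t$ with $x_1(t)<\dots<x_n(t)$ is open, on $I$ one has $\dot x_j=u(x_j)^2-\langle u_x^2\rangle(x_j)$ for $1\le j\le n$, and $$u(x,t)=\sum_{k=1}^n m_{k}\,e^{-|x-x_{k}(t)|}$$ solves (mCH) on $I$. (2) For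 all $x_1^0<\dots<x_n^0$ there is an admissible $(\zeta;b(0);c)$ such that the positions in (1) satisfy $x_j(0)=x_j^0$ for all $j$. Thus every ordered initial configuration evolves, on an open time set containing $0$, by the formulas above. -/

import Mathlib

open Filter Topology MeasureTheory
open scoped ContDiff

noncomputable section

namespace MCH

/-! ### Peakons and the regularized equation -/

/-- The multipeakon profile `u(y) = ∑ m_j exp(-|y - x_j|)`. -/
def multipeakon {n : ℕ} (m x : Fin n → ℝ) (y : ℝ) : ℝ :=
  ∑ j, m j * Real.exp (-|y - x j|)

/-- The average function `⟨f⟩`: arithmetic mean of the left-hand and right-hand limits. -/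
def avg (f : ℝ → ℝ) (y : ℝ) : ℝ :=
  (Function.leftLim f y + Function.rightLim f y) / 2

/-- The velocity field `u² - ⟨u_x²⟩` attached to a profile `v = u(·, t)`. -/
def velocity (v : ℝ → ℝ) (y : ℝ) : ℝ :=
  v y ^ 2 - avg (fun w => deriv v w ^ 2) y

/-- `u` (written `u t y`, time first) solves
`m_t + ((u² - ⟨u_x²⟩) m)_x = 0`, `m = u - u_xx`, on the open set of times `I`.
Here `m(t)` is a measure `M t` on the line with `u - u_xx = M t` in the sense of distributions,
`u(·, t)` is continuous and `u_x(·, t)` has one-sided limits everywhere, so that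
`u² - ⟨u_x²⟩` is a function defined at every point and can be multiplied by `M t`; the time
derivative of `m` is the distributional one, i.e. the limit of difference quotients tested against
an arbitrary smooth compactly supported `φ`. -/
def IsRegularizedSolution (u : ℝ → ℝ → ℝ) (I : Set ℝ) : Prop :=
  IsOpen I ∧ ∃ M : ℝ → Measure ℝ, ∀ t ∈ I,
    IsFiniteMeasureOnCompacts (M t) ∧
    Continuous (u t) ∧
    (∀ y, (∃ a, Tendsto (deriv (u t)) (𝓝[<] y) (𝓝 a)) ∧
      (∃ a, Tendsto (deriv (u t)) (𝓝[>] y) (𝓝 a))) ∧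
    ∀ φ : ℝ → ℝ, ContDiff ℝ ∞ φ → HasCompactSupport φ →
      (∫ y, u t y * (φ y - deriv (deriv φ) y)) = (∫ y, φ y ∂(M t)) ∧
      Integrable (fun y => velocity (u t) y * deriv φ y) (M t) ∧
      HasDerivAt (fun s => ∫ y, φ y ∂(M s)) (∫ y, velocity (u t) y * deriv φ y ∂(M t)) t

/-! ### The boundary value problem and its spectral data -/

/-- The pairs `(q_k(z), p_k(z))`, `0 ≤ k ≤ n`, of the initial value problem
`q_k - q_{k-1} = h_k p_{k-1}`, `p_k - p_{k-1} = -z g_k q_{k-1}`, `q_0 = 0`, `p_0 = 1`,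
with `h_k = m_k exp(x_k)` and `g_k = m_k exp(-x_k)`. -/
def qp {n : ℕ} (m x : Fin n → ℝ) (z : ℂ) : Fin (n + 1) → ℂ × ℂ :=
  Fin.induction (motive := fun _ => ℂ × ℂ) (0, 1) fun k s =>
    (s.1 + ((m k * Real.exp (x k) : ℝ) : ℂ) * s.2,
      s.2 - z * ((m k * Real.exp (-x k) : ℝ) : ℂ) * s.1)

/-- Admissible spectral data for `n` peakons: `⌊n/2⌋` eigenvalues `0 < ζ_1 < ζ_2 < ⋯`, positive
weights `b_j`, and a shift `c` which is `0` for even `n` and positive for odd `n`. -/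
structure IsAdmissible (n : ℕ) (ζ b : Fin (n / 2) → ℝ) (c : ℝ) : Prop where
  strictMono : StrictMono ζ
  eigenvalue_pos : ∀ j, 0 < ζ j
  weight_pos : ∀ j, 0 < b j
  shift_even : Even n → c = 0
  shift_odd : Odd n → 0 < c

/-- The boundary value problem with masses `m` and positions `x` has spectral data
`(∑ b_j δ_{ζ_j}, c)`: its spectrum (the zeros of `p_n`) is `{ζ_j}` and its Weyl function `q_n / p_n`
is the shifted Stieltjes transform `c + ∑ b_j / (ζ_j - z)`. -/
def HasSpectralData {n : ℕ} (m x : Fin n → ℝ) (ζ b : Fin (n / 2) → ℝ) (c : ℝ) : Prop :=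
  ∀ z : ℂ,
    ((qp m x z (Fin.last n)).2 = 0 ↔ ∃ j, z = (ζ j : ℂ)) ∧
    ((qp m x z (Fin.last n)).2 ≠ 0 →
      (qp m x z (Fin.last n)).1 / (qp m x z (Fin.last n)).2
        = (c : ℂ) + ∑ j, (b j : ℂ) / ((ζ j : ℂ) - z))

/-! ### The determinantal inverse formulas -/

/-- `c + ∫ dμ(ξ) / (y + ξ)` for `μ = ∑ b_j δ_{ζ_j}`. -/
def stieltjes {K : ℕ} (ζ b : Fin K → ℝ) (c y : ℝ) : ℝ :=
  c + ∑ j, b j / (y + ζ j)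

/-- The `k × k` Cauchy-Stieltjes-Vandermonde matrix: row `i` is
`e_i^p μ̂(e_i), …, e_i^(p+l-1) μ̂(e_i), 1, e_i, …, e_i^(k-l-1)`. -/
def csv {K k : ℕ} (l p : ℕ) (e : Fin k → ℝ) (ζ b : Fin K → ℝ) (c : ℝ) :
    Matrix (Fin k) (Fin k) ℝ :=
  Matrix.of fun i j =>
    if (j : ℕ) < l then e i ^ (p + (j : ℕ)) * stieltjes ζ b c (e i) else e i ^ ((j : ℕ) - l)

/-- The nodes `e_j = 1 / m_{j'}²`, `j' = n + 1 - j` (masses counted from the right). -/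
def node {n : ℕ} (m : Fin n → ℝ) (j : Fin n) : ℝ :=
  1 / m j.rev ^ 2

/-- `𝒟_k^{(l,p)}`, the absolute value of the CSV determinant on the first `k` nodes
(equal to `1` for `k = 0`). -/
def calD {n K : ℕ} (m : Fin n → ℝ) (ζ b : Fin K → ℝ) (c : ℝ) (k : ℕ) (hk : k ≤ n) (l p : ℕ) : ℝ :=
  |(csv l p (fun j : Fin k => node m (Fin.castLE hk j)) ζ b c).det|

/-- The argument of the logarithm in the inverse formulas for the position `x_{k'}`,
`k' = n + 1 - k`. The particle `k'` is the index `i : Fin n` (from the left, starting at `0`)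
with `k = n - i`. -/
def expPosition {n K : ℕ} (m : Fin n → ℝ) (ζ b : Fin K → ℝ) (c : ℝ) (i : Fin n) : ℝ :=
  let k := n - (i : ℕ)
  let hk : k ≤ n := Nat.sub_le n i
  let hk' : k - 1 ≤ n := (Nat.sub_le k 1).trans hk
  if Odd k then
    ((∏ j : Fin (k - 1), node m (Fin.castLE hk' j)) *
        calD m ζ b c k hk ((k + 1) / 2) 0 * calD m ζ b c (k - 1) hk' ((k - 1) / 2) 0) /
      (m i * calD m ζ b c k hk ((k - 1) / 2) 1 * calD m ζ b c (k - 1) hk' ((k - 1) / 2) 1)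
  else
    ((∏ j : Fin (k - 1), node m (Fin.castLE hk' j)) *
        calD m ζ b c k hk (k / 2) 0 * calD m ζ b c (k - 1) hk' (k / 2) 0) /
      (m i * calD m ζ b c k hk (k / 2) 1 * calD m ζ b c (k - 1) hk' (k / 2 - 1) 1)

/-- Vectors of positive, pairwise distinct masses. -/
def distinctMasses (n : ℕ) : Set (Fin n → ℝ) :=
  {m | (∀ j, 0 < m j) ∧ Function.Injective m}

/-- The position `x_i` given by the inverse formulas, extended by continuity in the masses from
distinct masses to all positive masses. -/
def position {n K : ℕ} (m : Fin n → ℝ) (ζ b : Fin K → ℝ) (c : ℝ) (i : Fin n) : ℝ :=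
  extendFrom (distinctMasses n) (fun m' => Real.log (expPosition m' ζ b c i)) m

/-- The evolved weights `b_j(t) = b_j(0) exp(2t / ζ_j)`. -/
def weightAt {K : ℕ} (ζ b : Fin K → ℝ) (t : ℝ) (j : Fin K) : ℝ :=
  b j * Real.exp (2 * t / ζ j)

/-- The positions at time `t`: inverse formulas with fixed masses, eigenvalues and shift, and with
the evolved weights. -/
def positionAt {n K : ℕ} (m : Fin n → ℝ) (ζ b : Fin K → ℝ) (c : ℝ) (t : ℝ) : Fin n → ℝ :=
  position m ζ (weightAt ζ b t) c

end MCH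

end

noncomputable section

namespace MCH

open Polynomial

/-! Put s = -z. Then q_k and p_k are real polynomials in s, and one step of the recursion is a 2 × 2
matrix of determinant 1 - m_k² s, because h_k g_k = m_k² does not involve the position. Everything
rests on the Weyl function W = q_n / p_n.

For fixed masses, configurations (ordered or not) correspond to admissible data. Forward: positivity
of the kernels of q/p and s q/p (`bvp_im`, `bvp_wronskian`) makes the zeros of p_n negative and
simple, with positive residues. Backward: at s = 1/m_k² step k is singular, so q_{k+1}/p_{k+1} takes
the value h_k there (indices from 0). This reads off the last position, and peeling it off leaves
admissible data for one particle fewer (`exists_reduced_data`, `exists_positions`); the same reading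
gives uniqueness (`positions_unique`). Distinct masses are not needed for this.

Peeling k particles at once turns W into the solution of an interpolation problem at the first k
nodes. For distinct nodes Cramer's rule expresses the alternating products of h and g as ratios of
determinants (`abs_det_csv_zero`), which yields the explicit formulas
(`FinSpectral.expPosition_eq`). For coinciding masses, monotonicity of q/p shows that the solution
of the inverse problem is continuous in the masses (`tendsto_positions`), so it is the limit of the
formulas.

The peakon system is the compatibility condition of a Lax pair (`hasDerivAt_eval_bvp`): p_n is
constant and the residues of W grow like e^{2t/ζ_j}. Uniqueness in the inverse problem then forces
the formulas to follow the flow at every time, ordered or not (`hasDerivAt_positionAt`). The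
ordering enters only through `velocity_multipeakon`, which identifies the right-hand side with u² -
⟨u_x²⟩ at the peaks; the weak equation is then the chain rule for a sum of Dirac masses. -/

/-! ### The boundary value problem as a recursion for real polynomials in `s = -z` -/

/-- The pairs `(q_k, p_k)` as polynomials in `s = -z`, for arbitrary coefficient sequences. -/
def bvp (h g : ℕ → ℝ) : ℕ → ℝ[X] × ℝ[X]
  | 0 => (0, 1)
  | k + 1 => ((bvp h g k).1 + C (h k) * (bvp h g k).2, (bvp h g k).2 + X * C (g k) * (bvp h g k).1)

/-- The polynomial `q_k(s)`. -/
def qPoly (h g : ℕ → ℝ) (k : ℕ) : ℝ[X] := (bvp h g k).1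

/-- The polynomial `p_k(s)`. -/
def pPoly (h g : ℕ → ℝ) (k : ℕ) : ℝ[X] := (bvp h g k).2

section Basic

variable (h g : ℕ → ℝ)

@[simp] lemma qPoly_zero : qPoly h g 0 = 0 := rfl

@[simp] lemma pPoly_zero : pPoly h g 0 = 1 := rfl

lemma qPoly_succ (k : ℕ) : qPoly h g (k + 1) = qPoly h g k + C (h k) * pPoly h g k := rfl

lemma pPoly_succ (k : ℕ) : pPoly h g (k + 1) = pPoly h g k + X * C (g k) * qPoly h g k := rfl

lemma eval_qPoly_succ (k : ℕ) (s : ℝ) :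
    (qPoly h g (k + 1)).eval s = (qPoly h g k).eval s + h k * (pPoly h g k).eval s := by
  simp [qPoly_succ]

lemma eval_pPoly_succ (k : ℕ) (s : ℝ) :
    (pPoly h g (k + 1)).eval s = (pPoly h g k).eval s + s * g k * (qPoly h g k).eval s := by
  simp only [pPoly_succ, eval_add, eval_mul, eval_X, eval_C]

lemma eval_zero_pPoly (k : ℕ) : (pPoly h g k).eval 0 = 1 := by
  induction k with
  | zero => simp
  | succ k ih => simp [eval_pPoly_succ, ih]

lemma eval_zero_qPoly (k : ℕ) : (qPoly h g k).eval 0 = ∑ j ∈ Finset.range k, h j := by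
  induction k with
  | zero => simp
  | succ k ih => simp [eval_qPoly_succ, ih, eval_zero_pPoly, Finset.sum_range_succ]

variable {h g}

lemma bvp_congr {h' g' : ℕ → ℝ} {n : ℕ} (hh : ∀ k < n, h k = h' k) (hg : ∀ k < n, g k = g' k) :
    qPoly h g n = qPoly h' g' n ∧ pPoly h g n = pPoly h' g' n := by
  induction n with
  | zero => simp
  | succ n ih =>
    obtain ⟨h1, h2⟩ := ih (fun k hk => hh k (by lia)) (fun k hk => hg k (by lia))
    simp [qPoly_succ, pPoly_succ, h1, h2, hh n (by lia), hg n (by lia)]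

lemma coeff_bvp_eq_zero (k : ℕ) :
    (∀ i, k < 2 * i + 1 → (qPoly h g k).coeff i = 0) ∧
      (∀ i, k < 2 * i → (pPoly h g k).coeff i = 0) := by
  induction k with
  | zero =>
    refine ⟨by simp, fun i hi => ?_⟩
    rw [pPoly_zero, coeff_one, if_neg (by lia)]
  | succ k ih =>
    refine ⟨fun i hi => ?_, fun i hi => ?_⟩
    · rw [qPoly_succ, coeff_add, coeff_C_mul, ih.1 i (by lia), ih.2 i (by lia)]
      simp
    · obtain ⟨j, rfl⟩ : ∃ j, i = j + 1 := ⟨i - 1, by lia⟩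
      rw [pPoly_succ, coeff_add, mul_assoc, coeff_X_mul, coeff_C_mul, ih.2 _ (by lia),
        ih.1 j (by lia)]
      simp

lemma natDegree_qPoly_le (k : ℕ) : (qPoly h g k).natDegree ≤ (k - 1) / 2 :=
  natDegree_le_iff_coeff_eq_zero.2 fun i hi => (coeff_bvp_eq_zero k).1 i (by lia)

lemma natDegree_pPoly_le (k : ℕ) : (pPoly h g k).natDegree ≤ k / 2 :=
  natDegree_le_iff_coeff_eq_zero.2 fun i hi => (coeff_bvp_eq_zero k).2 i (by lia)

/-- The alternating product `h_{k-1} g_{k-2} h_{k-3} ⋯`. -/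
def altProd : (ℕ → ℝ) → (ℕ → ℝ) → ℕ → ℝ
  | _, _, 0 => 1
  | h, g, k + 1 => h k * altProd g h k

lemma altProd_pos {k : ℕ} : ∀ {h g : ℕ → ℝ}, (∀ j, 0 < h j) → (∀ j, 0 < g j) →
    0 < altProd h g k := by
  induction k with
  | zero => intros; simp [altProd]
  | succ k ih => intro h g hh hg; exact mul_pos (hh k) (ih hg hh)

lemma altProd_mul_altProd (k : ℕ) : ∀ h g : ℕ → ℝ,
    altProd h g k * altProd g h k = ∏ j ∈ Finset.range k, h j * g j := by
  induction k with
  | zero => simp [altProd]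
  | succ k ih =>
    intro h g
    rw [Finset.prod_range_succ, ← ih h g, altProd, altProd]
    ring

/-- A power of s is gained only by a g-step following an h-step, so the extreme power comes from the
single path that alternates h and g through all indices. -/
lemma coeff_bvp_top (l : ℕ) :
    (pPoly h g (2 * l)).coeff l = altProd g h (2 * l) ∧
      (qPoly h g (2 * l + 1)).coeff l = altProd h g (2 * l + 1) := by
  induction l with
  | zero => simp [altProd, qPoly_succ]
  | succ l ih =>
    have h1 : (pPoly h g (2 * (l + 1))).coeff (l + 1) = altProd g h (2 * (l + 1)) := by
      rw [show 2 * (l + 1) = 2 * l + 1 + 1 by ring, pPoly_succ, coeff_add, mul_assoc,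
        coeff_X_mul, coeff_C_mul, ih.2, (coeff_bvp_eq_zero _).2 _ (by lia)]
      simp [altProd]
    refine ⟨h1, ?_⟩
    rw [qPoly_succ, coeff_add, coeff_C_mul, h1, (coeff_bvp_eq_zero _).1 _ (by lia), altProd]
    simp

lemma coeff_bvp_nonneg (hh : ∀ j, 0 < h j) (hg : ∀ j, 0 < g j) (k i : ℕ) :
    0 ≤ (qPoly h g k).coeff i ∧ 0 ≤ (pPoly h g k).coeff i := by
  induction k generalizing i with
  | zero =>
    simp only [qPoly_zero, coeff_zero, le_refl, pPoly_zero, coeff_one, true_and]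
    split_ifs <;> norm_num
  | succ k ih =>
    rw [qPoly_succ, pPoly_succ, coeff_add, coeff_add, coeff_C_mul, mul_assoc]
    refine ⟨add_nonneg (ih i).1 (mul_nonneg (hh k).le (ih i).2), add_nonneg (ih i).2 ?_⟩
    cases i with
    | zero => simp
    | succ i =>
      rw [coeff_X_mul, coeff_C_mul]
      exact mul_nonneg (hg k).le (ih i).1

lemma coeff_pPoly_top_pos (hh : ∀ j, 0 < h j) (hg : ∀ j, 0 < g j) (n : ℕ) :
    0 < (pPoly h g n).coeff (n / 2) := by
  rcases Nat.even_or_odd' n with ⟨l, rfl | rfl⟩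
  · rw [Nat.mul_div_cancel_left l two_pos, (coeff_bvp_top l).1]
    exact altProd_pos hg hh
  · rw [show (2 * l + 1) / 2 = l by lia, pPoly_succ, coeff_add, (coeff_bvp_top l).1]
    refine add_pos_of_pos_of_nonneg (altProd_pos hg hh) ?_
    cases l with
    | zero => simp
    | succ l =>
      rw [mul_assoc, coeff_X_mul, coeff_C_mul]
      exact mul_nonneg (hg _).le (coeff_bvp_nonneg hh hg _ _).1

lemma coeff_qPoly_even (l : ℕ) : (qPoly h g (2 * l)).coeff l = 0 :=
  (coeff_bvp_eq_zero _).1 _ (by lia)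

lemma eval_bvp_nonneg (hh : ∀ j, 0 < h j) (hg : ∀ j, 0 < g j) {s : ℝ} (hs : 0 ≤ s) (k : ℕ) :
    0 ≤ (qPoly h g k).eval s ∧ 0 < (pPoly h g k).eval s := by
  induction k with
  | zero => simp
  | succ k ih =>
    rw [eval_qPoly_succ, eval_pPoly_succ]
    have := mul_nonneg (hh k).le ih.2.le
    have := mul_nonneg (mul_nonneg hs (hg k).le) ih.1
    constructor <;> linarith [ih.1, ih.2]

/-- The recursion can be run backwards, up to the determinant `1 - h_k g_k s`. -/
lemma bvp_backward (k : ℕ) :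
    (1 - C (h k * g k) * X) * qPoly h g k = qPoly h g (k + 1) - C (h k) * pPoly h g (k + 1) ∧
    (1 - C (h k * g k) * X) * pPoly h g k =
      pPoly h g (k + 1) - C (g k) * X * qPoly h g (k + 1) := by
  rw [qPoly_succ, pPoly_succ, C_mul]
  constructor <;> ring

/-- At the node `s = 1 / (h_k g_k)` the quotient `q_{k+1} / p_{k+1}` equals `h_k`. -/
lemma eval_qPoly_succ_of_node {k : ℕ} {s : ℝ} (hs : s * (h k * g k) = 1) :
    (qPoly h g (k + 1)).eval s = h k * (pPoly h g (k + 1)).eval s := by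
  rw [eval_qPoly_succ, eval_pPoly_succ]
  linear_combination (-(qPoly h g k).eval s) * hs

/-- Two-point positivity: `q/p` decreases and `s q/p` increases on `s ≥ 0`. -/
lemma bvp_two_point (hh : ∀ j, 0 < h j) (hg : ∀ j, 0 < g j) {s t : ℝ} (hs : 0 ≤ s) (ht : s ≤ t)
    (k : ℕ) :
    (qPoly h g k).eval t * (pPoly h g k).eval s ≤ (qPoly h g k).eval s * (pPoly h g k).eval t ∧
    s * (qPoly h g k).eval s * (pPoly h g k).eval t ≤
      t * (qPoly h g k).eval t * (pPoly h g k).eval s := by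
  induction k with
  | zero => simp
  | succ k ih =>
    have ht0 : 0 ≤ t := hs.trans ht
    simp only [eval_qPoly_succ, eval_pPoly_succ]
    obtain ⟨qs, ps⟩ := eval_bvp_nonneg hh hg hs k
    obtain ⟨qt, pt⟩ := eval_bvp_nonneg hh hg ht0 k
    generalize (qPoly h g k).eval s = a at *
    generalize (qPoly h g k).eval t = a' at *
    generalize (pPoly h g k).eval s = b at *
    generalize (pPoly h g k).eval t = b' at *
    have hts : 0 ≤ t - s := sub_nonneg.2 ht
    -- The first difference at k + 1 is the one at k plus the terms of `e1` and `e3`; the second is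
    -- the one at k plus those of `e2` and `e4`.
    have e1 : 0 ≤ (t - s) * (g k * (a * a')) :=
      mul_nonneg hts (mul_nonneg (hg k).le (mul_nonneg qs qt))
    have e2 : 0 ≤ (t - s) * (h k * (b * b')) :=
      mul_nonneg hts (mul_nonneg (hh k).le (mul_nonneg ps.le pt.le))
    have e3 : 0 ≤ h k * g k * (t * a' * b - s * a * b') :=
      mul_nonneg (mul_pos (hh k) (hg k)).le (sub_nonneg.2 ih.2)
    have e4 : 0 ≤ s * t * (h k * g k) * (a * b' - a' * b) :=
      mul_nonneg (mul_nonneg (mul_nonneg hs ht0) (mul_pos (hh k) (hg k)).le) (sub_nonneg.2 ih.1)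
    constructor <;> nlinarith [ih.1, ih.2]

/-- Confluent positivity: the Wronskian of `p` and `q` on the real line. -/
lemma bvp_wronskian (hh : ∀ j, 0 < h j) (hg : ∀ j, 0 < g j) (s : ℝ) (k : ℕ) :
    (0 ≤ (qPoly h g k).eval s * (pPoly h g k).derivative.eval s -
      (qPoly h g k).derivative.eval s * (pPoly h g k).eval s) ∧
    (0 ≤ (qPoly h g k).eval s * (pPoly h g k).eval s +
      s * ((qPoly h g k).derivative.eval s * (pPoly h g k).eval s -
        (qPoly h g k).eval s * (pPoly h g k).derivative.eval s)) ∧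
    (1 ≤ k → 0 < (qPoly h g k).eval s * (pPoly h g k).eval s +
      s * ((qPoly h g k).derivative.eval s * (pPoly h g k).eval s -
        (qPoly h g k).eval s * (pPoly h g k).derivative.eval s)) ∧
    (2 ≤ k → 0 < (qPoly h g k).eval s * (pPoly h g k).derivative.eval s -
      (qPoly h g k).derivative.eval s * (pPoly h g k).eval s) := by
  induction k with
  | zero => simp
  | succ k ih =>
    have hd1 : (qPoly h g (k + 1)).derivative.eval s =
        (qPoly h g k).derivative.eval s + h k * (pPoly h g k).derivative.eval s := by
      simp [qPoly_succ]
    have hd2 : (pPoly h g (k + 1)).derivative.eval s = (pPoly h g k).derivative.eval s +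
        g k * (qPoly h g k).eval s + s * g k * (qPoly h g k).derivative.eval s := by
      simp [pPoly_succ]
      ring
    rw [hd1, hd2, eval_qPoly_succ, eval_pPoly_succ]
    obtain ⟨i1, i2, i3, i4⟩ := ih
    have hk0 : k = 0 → (pPoly h g k).eval s = 1 := by rintro rfl; simp
    generalize (qPoly h g k).eval s = a at *
    generalize (pPoly h g k).eval s = b at *
    generalize (qPoly h g k).derivative.eval s = a' at *
    generalize (pPoly h g k).derivative.eval s = b' at *
    have hgk := mul_pos (hh k) (hg k)
    -- Each expression at k + 1 combines both expressions at k with nonnegative weights and adds a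
    -- square. Strictness starts from p_0 = 1 and reaches the first expression one step later.
    have e1 : (a + h k * b) * (b' + g k * a + s * g k * a') - (a' + h k * b') * (b + s * g k * a) =
        (a * b' - a' * b) + g k * a ^ 2 + h k * g k * (a * b + s * (a' * b - a * b')) := by ring
    have e2 : (a + h k * b) * (b + s * g k * a) + s * ((a' + h k * b') * (b + s * g k * a) -
        (a + h k * b) * (b' + g k * a + s * g k * a')) =
        (a * b + s * (a' * b - a * b')) + h k * b ^ 2 + s ^ 2 * (h k * g k) * (a * b' - a' * b) := by
      ring
    rw [e1, e2]
    have f1 := mul_nonneg (hg k).le (sq_nonneg a)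
    have f2 := mul_nonneg hgk.le i2
    have f3 := mul_nonneg (hh k).le (sq_nonneg b)
    have f4 := mul_nonneg (mul_nonneg (sq_nonneg s) hgk.le) i1
    refine ⟨by linarith, by linarith, fun _ => ?_, fun hk => ?_⟩
    · rcases Nat.eq_zero_or_pos k with hk | hk
      · have := hk0 hk
        have : 0 < h k * b ^ 2 := by rw [this]; simpa using hh k
        linarith
      · linarith [i3 hk]
    · have := mul_pos hgk (i3 (by lia))
      linarith

lemma aeval_qPoly_succ (k : ℕ) (z : ℂ) :
    aeval z (qPoly h g (k + 1)) = aeval z (qPoly h g k) + h k * aeval z (pPoly h g k) := by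
  simp [qPoly_succ]

lemma aeval_pPoly_succ (k : ℕ) (z : ℂ) :
    aeval z (pPoly h g (k + 1)) = aeval z (pPoly h g k) + z * g k * aeval z (qPoly h g k) := by
  simp only [pPoly_succ, map_add, map_mul, aeval_X, aeval_C, Complex.coe_algebraMap]

/-- Positivity of the kernels of `q/p` and `s q/p` at a pair of conjugate points. -/
lemma bvp_im (hh : ∀ j, 0 < h j) (hg : ∀ j, 0 < g j) (z : ℂ) (k : ℕ) :
    ∃ u v : ℝ, 0 ≤ u ∧ 0 ≤ v ∧ (1 ≤ k → 0 < v) ∧ (2 ≤ k → 0 < u) ∧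
      (aeval z (qPoly h g k) * (starRingEnd ℂ) (aeval z (pPoly h g k))).im = -z.im * u ∧
      (z * aeval z (qPoly h g k) * (starRingEnd ℂ) (aeval z (pPoly h g k))).im = z.im * v := by
  induction k with
  | zero => exact ⟨0, 0, by simp⟩
  | succ k ih =>
    obtain ⟨u, v, hu, hv, hv1, hu2, i1, i2⟩ := ih
    rw [aeval_qPoly_succ, aeval_pPoly_succ]
    have hk0 : k = 0 → aeval z (pPoly h g k) = 1 := by rintro rfl; simp
    generalize aeval z (qPoly h g k) = a at *
    generalize aeval z (pPoly h g k) = b at *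
    have hgk := mul_pos (hh k) (hg k)
    have f1 := mul_nonneg (hg k).le (Complex.normSq_nonneg a)
    have f2 := mul_nonneg hgk.le hv
    have f3 := mul_nonneg (hh k).le (Complex.normSq_nonneg b)
    have f4 := mul_nonneg (mul_nonneg (Complex.normSq_nonneg z) hgk.le) hu
    -- The recursion of the Wronskians, with `normSq` in place of the squares.
    refine ⟨u + g k * Complex.normSq a + h k * g k * v,
      v + h k * Complex.normSq b + Complex.normSq z * (h k * g k) * u, by linarith, by linarith,
      fun _ => ?_, fun hk => ?_, ?_, ?_⟩
    · rcases Nat.eq_zero_or_pos k with hk | hk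
      · have : 0 < h k * Complex.normSq b := by rw [hk0 hk]; simpa using hh k
        linarith
      · linarith [hv1 hk]
    · have := mul_pos hgk (hv1 (by lia))
      linarith
    · simp only [Complex.mul_im, Complex.mul_re, Complex.add_im, Complex.add_re, Complex.conj_im,
        Complex.conj_re, Complex.ofReal_re, Complex.ofReal_im, Complex.normSq_apply] at *
      linear_combination i1 - (h k * g k) * i2
    · simp only [Complex.mul_im, Complex.mul_re, Complex.add_im, Complex.add_re, Complex.conj_im,
        Complex.conj_re, Complex.ofReal_re, Complex.ofReal_im, Complex.normSq_apply] at *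
      linear_combination i2 - ((z.re * z.re + z.im * z.im) * (h k * g k)) * i1

/-- All complex zeros of `p_n` are real and negative, and `q_n p_n' > 0` there. -/
lemma pPoly_root (hh : ∀ j, 0 < h j) (hg : ∀ j, 0 < g j) {n : ℕ} {z : ℂ}
    (hz : aeval z (pPoly h g n) = 0) :
    z.im = 0 ∧ z.re < 0 ∧
      0 < (qPoly h g n).eval z.re * (pPoly h g n).derivative.eval z.re := by
  have hn : 2 ≤ n := by
    by_contra hn
    have : n = 0 ∨ n = 1 := by lia
    rcases this with rfl | rfl <;> simp [pPoly_succ] at hz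
  -- At a zero of p the kernel identity reads 0 = -z.im * u, and u > 0 once n ≥ 2.
  have him : z.im = 0 := by
    obtain ⟨u, v, -, -, -, hu, h1, -⟩ := bvp_im hh hg z n
    rw [hz] at h1
    have := (hu hn).ne'
    simpa [this] using h1.symm
  have hzr : (z.re : ℂ) = z := by apply Complex.ext <;> simp [him]
  have hr : (pPoly h g n).eval z.re = 0 := by
    rw [← hzr] at hz
    have : ((Polynomial.eval z.re (pPoly h g n) : ℝ) : ℂ) = 0 := by
      rw [← hz]
      exact (aeval_algebraMap_apply_eq_algebraMap_eval (A := ℂ) z.re _).symm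
    exact_mod_cast this
  refine ⟨him, ?_, ?_⟩
  · by_contra hneg
    exact (eval_bvp_nonneg hh hg (not_lt.1 hneg) n).2.ne' hr
  · have := (bvp_wronskian hh hg z.re n).2.2.2 hn
    rw [hr] at this
    linarith

end Basic

/-! ### Partial fractions -/

section PartialFractions

variable {K : ℕ}

/-- The normalized polynomial `∏ (1 + s / ζ_j)`. -/
def dataP (ζ : Fin K → ℝ) : ℝ[X] := C (∏ j, (ζ j)⁻¹) * ∏ j, (X + C (ζ j))

/-- The quotient of `dataP ζ` by `s + ζ_j`. -/
def dataN (ζ : Fin K → ℝ) (j : Fin K) : ℝ[X] :=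
  C (∏ j, (ζ j)⁻¹) * ∏ i ∈ Finset.univ.erase j, (X + C (ζ i))

/-- The numerator of `c + ∑ b_j / (s + ζ_j)` over the denominator `dataP ζ`. -/
def dataQ (ζ b : Fin K → ℝ) (c : ℝ) : ℝ[X] := C c * dataP ζ + ∑ j, C (b j) * dataN ζ j

variable (ζ b : Fin K → ℝ) (c : ℝ)

lemma dataP_eq_mul_dataN (j : Fin K) : dataP ζ = (X + C (ζ j)) * dataN ζ j := by
  rw [dataP, dataN, ← Finset.mul_prod_erase _ (fun j => X + C (ζ j)) (Finset.mem_univ j)]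
  ring

lemma natDegree_prod_X_add_C (s : Finset (Fin K)) :
    (∏ j ∈ s, (X + C (ζ j))).natDegree = s.card := by
  rw [natDegree_prod_of_monic _ _ fun j _ => monic_X_add_C _]
  simp

lemma coeff_prod_X_add_C (s : Finset (Fin K)) :
    (∏ j ∈ s, (X + C (ζ j))).coeff s.card = 1 := by
  conv_lhs => rw [← natDegree_prod_X_add_C ζ s]
  exact (monic_prod_of_monic _ _ fun j _ => monic_X_add_C _).coeff_natDegree

lemma natDegree_dataP_le : (dataP ζ).natDegree ≤ K :=
  (natDegree_C_mul_le _ _).trans (by rw [natDegree_prod_X_add_C]; simp)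

lemma coeff_dataP : (dataP ζ).coeff K = ∏ j, (ζ j)⁻¹ := by
  have := coeff_prod_X_add_C ζ Finset.univ
  rw [Finset.card_univ, Fintype.card_fin] at this
  rw [dataP, coeff_C_mul, this, mul_one]

lemma natDegree_dataN_le (j : Fin K) : (dataN ζ j).natDegree ≤ K - 1 :=
  (natDegree_C_mul_le _ _).trans (by rw [natDegree_prod_X_add_C]; simp)

lemma coeff_dataN (j : Fin K) : (dataN ζ j).coeff (K - 1) = ∏ j, (ζ j)⁻¹ := by
  have := coeff_prod_X_add_C ζ (Finset.univ.erase j)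
  rw [Finset.card_erase_of_mem (Finset.mem_univ j), Finset.card_univ, Fintype.card_fin] at this
  rw [dataN, coeff_C_mul, this, mul_one]

lemma coeff_dataN_eq_zero (j : Fin K) : (dataN ζ j).coeff K = 0 :=
  coeff_eq_zero_of_natDegree_lt ((natDegree_dataN_le ζ j).trans_lt (by have := j.pos; lia))

lemma coeff_dataQ : (dataQ ζ b c).coeff K = c * ∏ j, (ζ j)⁻¹ := by
  simp [dataQ, coeff_dataN_eq_zero, coeff_dataP]

lemma natDegree_dataQ_le : (dataQ ζ b c).natDegree ≤ K := by
  refine natDegree_add_le_of_degree_le ((natDegree_C_mul_le _ _).trans (natDegree_dataP_le ζ)) ?_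
  refine natDegree_sum_le_of_forall_le _ _ fun j _ => ?_
  exact (natDegree_C_mul_le _ _).trans ((natDegree_dataN_le ζ j).trans (Nat.sub_le _ _))

variable {ζ}

lemma eval_zero_dataP (h0 : ∀ j, ζ j ≠ 0) : (dataP ζ).eval 0 = 1 := by
  simp only [dataP, eval_mul, eval_C, eval_prod, eval_add, eval_X, zero_add]
  rw [← Finset.prod_mul_distrib]
  exact Finset.prod_eq_one fun j _ => inv_mul_cancel₀ (h0 j)

lemma eval_zero_dataN (h0 : ∀ j, ζ j ≠ 0) (j : Fin K) : (dataN ζ j).eval 0 = (ζ j)⁻¹ := by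
  have := congrArg (eval 0) (dataP_eq_mul_dataN ζ j)
  rw [eval_zero_dataP h0] at this
  simp only [eval_mul, eval_add, eval_X, eval_C, zero_add] at this
  exact eq_inv_of_mul_eq_one_right this.symm

lemma eval_zero_dataQ (h0 : ∀ j, ζ j ≠ 0) :
    (dataQ ζ b c).eval 0 = c + ∑ j, b j / ζ j := by
  simp [dataQ, eval_finsetSum, eval_zero_dataN h0, eval_zero_dataP h0, div_eq_mul_inv]

lemma eval_dataN_of_ne {i j : Fin K} (hij : i ≠ j) : (dataN ζ j).eval (-ζ i) = 0 := by
  rw [dataN, eval_mul, eval_prod,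
    Finset.prod_eq_zero (Finset.mem_erase.2 ⟨hij, Finset.mem_univ i⟩) (by simp), mul_zero]

lemma eval_dataN_self_ne_zero (hζ : Function.Injective ζ) (h0 : ∀ j, ζ j ≠ 0) (j : Fin K) :
    (dataN ζ j).eval (-ζ j) ≠ 0 := by
  rw [dataN, eval_mul, eval_prod, eval_C]
  refine mul_ne_zero (Finset.prod_ne_zero_iff.2 fun i _ => inv_ne_zero (h0 i))
    (Finset.prod_ne_zero_iff.2 fun i hi => ?_)
  have : ζ i ≠ ζ j := fun h => Finset.ne_of_mem_erase hi (hζ h)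
  simpa [neg_add_eq_zero] using this.symm

lemma eval_dataP_root (j : Fin K) : (dataP ζ).eval (-ζ j) = 0 := by
  rw [dataP_eq_mul_dataN ζ j]; simp

lemma eval_dataQ_root (j : Fin K) :
    (dataQ ζ b c).eval (-ζ j) = b j * (dataN ζ j).eval (-ζ j) := by
  simp only [dataQ, eval_add, eval_mul, eval_C, eval_dataP_root, eval_finsetSum]
  rw [Finset.sum_eq_single j (fun i _ hi => by rw [eval_dataN_of_ne hi.symm, mul_zero]) (by simp)]
  ring

lemma eval_derivative_dataP (j : Fin K) :
    (dataP ζ).derivative.eval (-ζ j) = (dataN ζ j).eval (-ζ j) := by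
  rw [dataP_eq_mul_dataN ζ j]; simp

lemma aeval_dataP_eq_zero_iff (h0 : ∀ j, ζ j ≠ 0) (z : ℂ) :
    aeval z (dataP ζ) = 0 ↔ ∃ j, z = -(ζ j : ℂ) := by
  have : (∏ j, (ζ j : ℂ)) ≠ 0 := Finset.prod_ne_zero_iff.2 fun j _ => by exact_mod_cast h0 j
  simp [dataP, map_prod, Finset.prod_eq_zero_iff, this, eq_neg_iff_add_eq_zero]

lemma aeval_dataQ {z : ℂ} (hz : aeval z (dataP ζ) ≠ 0) :
    aeval z (dataQ ζ b c) = aeval z (dataP ζ) * ((c : ℂ) + ∑ j, (b j : ℂ) / (z + ζ j)) := by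
  simp only [dataQ, map_add, map_mul, map_sum, aeval_C, Complex.coe_algebraMap, mul_add,
    Finset.mul_sum]
  congr 1
  · ring
  · refine Finset.sum_congr rfl fun j _ => ?_
    rw [dataP_eq_mul_dataN ζ j] at hz ⊢
    simp only [map_mul, map_add, aeval_X, aeval_C, Complex.coe_algebraMap] at hz ⊢
    have := left_ne_zero_of_mul hz
    field_simp

lemma eval_dataP_pos (h0 : ∀ j, 0 < ζ j) {s : ℝ} (hs : 0 ≤ s) : 0 < (dataP ζ).eval s := by
  simp only [dataP, eval_mul, eval_C, eval_prod, eval_add, eval_X]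
  exact mul_pos (Finset.prod_pos fun j _ => inv_pos.2 (h0 j))
    (Finset.prod_pos fun j _ => by have := h0 j; positivity)

lemma eval_dataQ (h0 : ∀ j, 0 < ζ j) {s : ℝ} (hs : 0 ≤ s) :
    (dataQ ζ b c).eval s = (dataP ζ).eval s * stieltjes ζ b c s := by
  simp only [dataQ, stieltjes, eval_add, eval_mul, eval_C, eval_finsetSum, mul_add,
    Finset.mul_sum]
  congr 1
  · ring
  · refine Finset.sum_congr rfl fun j _ => ?_
    rw [dataP_eq_mul_dataN ζ j]
    simp only [eval_mul, eval_add, eval_X, eval_C]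
    have : s + ζ j ≠ 0 := by have := h0 j; positivity
    field_simp

/-- A polynomial of degree at most `K` is determined by its values at `K` points and its
coefficient of order `K`. -/
lemma eq_of_coeff_of_eval {p q : ℝ[X]} (hζ : Function.Injective ζ)
    (hp : p.natDegree ≤ K) (hq : q.natDegree ≤ K) (hc : p.coeff K = q.coeff K)
    (he : ∀ j, p.eval (-ζ j) = q.eval (-ζ j)) : p = q := by
  rw [← sub_eq_zero]
  refine eq_zero_of_degree_lt_of_eval_index_eq_zero (s := Finset.univ) (v := fun j => -ζ j)
    (fun i _ j _ hij => hζ (neg_injective hij)) ?_ fun j _ => by rw [eval_sub, he, sub_self]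
  rw [Finset.card_univ, Fintype.card_fin, degree_lt_iff_coeff_zero]
  intro i hi
  rcases hi.eq_or_lt with rfl | hi
  · rw [coeff_sub, hc, sub_self]
  · rw [coeff_sub, coeff_eq_zero_of_natDegree_lt (hp.trans_lt hi),
      coeff_eq_zero_of_natDegree_lt (hq.trans_lt hi), sub_self]

/-- Partial fraction decomposition over simple poles. -/
lemma eq_dataQ (hζ : Function.Injective ζ) (h0 : ∀ j, ζ j ≠ 0) {q : ℝ[X]} (hq : q.natDegree ≤ K) :
    q = dataQ ζ (fun j => q.eval (-ζ j) / (dataN ζ j).eval (-ζ j))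
      (q.coeff K / (dataP ζ).coeff K) := by
  refine eq_of_coeff_of_eval hζ hq (natDegree_dataQ_le _ _ _) ?_ fun j => ?_
  · rw [coeff_dataQ, coeff_dataP, div_mul_cancel₀]
    exact Finset.prod_ne_zero_iff.2 fun i _ => inv_ne_zero (h0 i)
  · rw [eval_dataQ_root, div_mul_cancel₀ _ (eval_dataN_self_ne_zero hζ h0 j)]

lemma eval_eq_zero_of_aeval {p : ℝ[X]} {r : ℝ} (h : aeval (r : ℂ) p = 0) : p.eval r = 0 := by
  have : ((Polynomial.eval r p : ℝ) : ℂ) = 0 := by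
    rw [← h]
    exact (aeval_algebraMap_apply_eq_algebraMap_eval (A := ℂ) r _).symm
  exact_mod_cast this

/-- A pair `(q, p)` whose zeros of `p` are negative with positive residues of `q / p` comes from
spectral data. -/
lemma exists_data {p q : ℝ[X]} {K : ℕ} (hpK : p.natDegree = K) (hp0 : p ≠ 0)
    (hqK : q.natDegree ≤ K)
    (hroot : ∀ z : ℂ, aeval z p = 0 → z.im = 0 ∧ z.re < 0 ∧
      0 < q.eval z.re * p.derivative.eval z.re) :
    ∃ ζ b : Fin K → ℝ, StrictMono ζ ∧ (∀ j, 0 < ζ j) ∧ (∀ j, 0 < b j) ∧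
      p = C (p.eval 0) * dataP ζ ∧
      q = C (p.eval 0) * dataQ ζ b (q.coeff K / p.coeff K) := by
  have hreal : ∀ r : ℝ, p.eval r = 0 → r < 0 ∧ 0 < q.eval r * p.derivative.eval r := by
    intro r hr
    have := hroot r (by
      rw [show ((r : ℝ) : ℂ) = algebraMap ℝ ℂ r from rfl, aeval_algebraMap_apply_eq_algebraMap_eval,
        hr, map_zero])
    simpa using this
  have hsplit : p.Splits := by
    refine Splits.of_splits_map (algebraMap ℝ ℂ) (IsAlgClosed.splits _) fun z hz => ?_
    have hz' : aeval z p = 0 := by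
      rw [aeval_def, ← eval_map]; exact isRoot_of_mem_roots hz
    exact ⟨z.re, by apply Complex.ext <;> simp [(hroot z hz').1]⟩
  -- At a multiple root p' would vanish, against 0 < q p'.
  have hnodup : p.roots.Nodup := by
    rw [Multiset.nodup_iff_count_le_one]
    intro r
    rw [count_roots]
    by_contra hr
    rw [not_le, one_lt_rootMultiplicity_iff_isRoot hp0] at hr
    have := (hreal r hr.1).2
    rw [show p.derivative.eval r = 0 from hr.2, mul_zero] at this
    exact this.false
  have hcard : (p.roots.toFinset.image fun r => -r).card = K := by
    rw [Finset.card_image_of_injective _ neg_injective, Multiset.toFinset_card_of_nodup hnodup,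
      ← hpK, hsplit.natDegree_eq_card_roots]
  set ζ := Finset.orderEmbOfFin _ hcard with hζdef
  have hζr : ∀ j, p.eval (-ζ j) = 0 := by
    intro j
    have := Finset.orderEmbOfFin_mem _ hcard j
    rw [Finset.mem_image] at this
    obtain ⟨r, hr, hrj⟩ := this
    rw [Multiset.mem_toFinset] at hr
    rw [hζdef, ← hrj, neg_neg]
    exact isRoot_of_mem_roots hr
  have hpos : ∀ j, 0 < ζ j := fun j => by have := (hreal _ (hζr j)).1; linarith
  have h0 : ∀ j, ζ j ≠ 0 := fun j => (hpos j).ne'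
  have hcoef : (dataP ζ).coeff K ≠ 0 := by
    rw [coeff_dataP]
    exact Finset.prod_ne_zero_iff.2 fun i _ => inv_ne_zero (h0 i)
  have hp : p = C (p.coeff K / (dataP ζ).coeff K) * dataP ζ := by
    refine eq_of_coeff_of_eval ζ.injective hpK.le
      ((natDegree_C_mul_le _ _).trans (natDegree_dataP_le ζ)) ?_ fun j => ?_
    · rw [coeff_C_mul, div_mul_cancel₀ _ hcoef]
    · rw [hζr, eval_mul, eval_dataP_root, mul_zero]
  set κ := p.coeff K / (dataP ζ).coeff K with hκ
  have hκ0 : p.eval 0 = κ := by rw [hp]; simp [eval_zero_dataP h0]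
  have hlead : p.coeff K ≠ 0 := by
    rw [← hpK]; exact leadingCoeff_ne_zero.2 hp0
  have hκne : κ ≠ 0 := div_ne_zero hlead hcoef
  refine ⟨ζ, fun j => κ⁻¹ * (q.eval (-ζ j) / (dataN ζ j).eval (-ζ j)), ζ.strictMono, hpos,
    fun j => ?_, by rw [hκ0]; exact hp, ?_⟩
  · have hd : p.derivative.eval (-ζ j) = κ * (dataN ζ j).eval (-ζ j) := by
      rw [hp]; simp [eval_derivative_dataP]
    have h1 := (hreal _ (hζr j)).2
    rw [hd] at h1
    have hN := eval_dataN_self_ne_zero ζ.injective h0 j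
    -- The residue q/p' written as q p' / p'², which shows its sign; here p' = κ N_j at -ζ_j.
    have : κ⁻¹ * (q.eval (-ζ j) / (dataN ζ j).eval (-ζ j)) =
        (q.eval (-ζ j) * (κ * (dataN ζ j).eval (-ζ j))) / (κ * (dataN ζ j).eval (-ζ j)) ^ 2 := by
      field_simp
    beta_reduce
    rw [this]
    have := mul_ne_zero hκne hN
    positivity
  · rw [hκ0]
    conv_lhs => rw [eq_dataQ ζ.injective h0 hqK]
    simp only [dataQ, mul_add, Finset.mul_sum, ← mul_assoc, ← C_mul]
    congr 1
    · congr 2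
      rw [hκ]
      field_simp
    · refine Finset.sum_congr rfl fun j _ => ?_
      rw [mul_inv_cancel₀ hκne, one_mul]

end PartialFractions

/-! ### The forward and the inverse spectral maps -/

/-- The coefficients `h_k = m_k exp(x_k)`. -/
def hSeq (m x : ℕ → ℝ) (k : ℕ) : ℝ := m k * Real.exp (x k)

/-- The coefficients `g_k = m_k exp(-x_k)`. -/
def gSeq (m x : ℕ → ℝ) (k : ℕ) : ℝ := m k * Real.exp (-x k)

/-- The positions cancel: the nodes 1/m_k² are known before the positions are. -/
lemma hSeq_mul_gSeq (m x : ℕ → ℝ) (k : ℕ) : hSeq m x k * gSeq m x k = m k ^ 2 := by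
  rw [hSeq, gSeq, mul_mul_mul_comm, ← Real.exp_add]
  simp [sq]

lemma hSeq_pos {m : ℕ → ℝ} (hm : ∀ k, 0 < m k) (x : ℕ → ℝ) (k : ℕ) : 0 < hSeq m x k :=
  mul_pos (hm k) (Real.exp_pos _)

lemma gSeq_pos {m : ℕ → ℝ} (hm : ∀ k, 0 < m k) (x : ℕ → ℝ) (k : ℕ) : 0 < gSeq m x k :=
  mul_pos (hm k) (Real.exp_pos _)

/-- The spectral data of the boundary value problem, in polynomial form. -/
def SpectralPoly (n : ℕ) (m x : ℕ → ℝ) (ζ b : Fin (n / 2) → ℝ) (c : ℝ) : Prop :=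
  qPoly (hSeq m x) (gSeq m x) n = dataQ ζ b c ∧ pPoly (hSeq m x) (gSeq m x) n = dataP ζ

/-- The forward spectral map. The normalization p_n(0) = 1 matches that of `dataP`, and c is the
ratio of the coefficients of order n / 2, whose sign is decided by the parity of n. -/
lemma exists_spectralPoly (n : ℕ) {m : ℕ → ℝ} (hm : ∀ k, 0 < m k) (x : ℕ → ℝ) :
    ∃ (ζ b : Fin (n / 2) → ℝ) (c : ℝ), IsAdmissible n ζ b c ∧ SpectralPoly n m x ζ b c := by
  have hh := hSeq_pos hm x
  have hg := gSeq_pos hm x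
  have htop := coeff_pPoly_top_pos hh hg n
  have hdeg : (pPoly (hSeq m x) (gSeq m x) n).natDegree = n / 2 :=
    le_antisymm (natDegree_pPoly_le n) (le_natDegree_of_ne_zero htop.ne')
  obtain ⟨ζ, b, hζ, hpos, hb, hp, hq⟩ := exists_data hdeg (fun h => by simp [h] at htop)
    ((natDegree_qPoly_le n).trans (Nat.div_le_div_right (Nat.sub_le _ _)))
    (fun z hz => pPoly_root hh hg hz)
  rw [eval_zero_pPoly, C_1, one_mul] at hp hq
  refine ⟨ζ, b, _, ⟨hζ, hpos, hb, ?_, ?_⟩, hq, hp⟩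
  · rintro ⟨l, rfl⟩
    rw [show l + l = 2 * l by ring, Nat.mul_div_cancel_left l two_pos, coeff_qPoly_even, zero_div]
  · rintro ⟨l, rfl⟩
    refine div_pos ?_ htop
    rw [show (2 * l + 1) / 2 = l by lia, (coeff_bvp_top l).2]
    exact altProd_pos hh hg

/-- One step of the inverse algorithm: splitting off the last particle. -/
lemma exists_reduced_data {n : ℕ} {ζ b : Fin ((n + 1) / 2) → ℝ} {c : ℝ}
    (had : IsAdmissible (n + 1) ζ b c) {e : ℝ} (he : 0 < e) :
    ∃ (ζ' b' : Fin (n / 2) → ℝ) (c' h : ℝ), IsAdmissible n ζ' b' c' ∧ 0 < h ∧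
      dataQ ζ' b' c' + C h * dataP ζ' = dataQ ζ b c ∧
      dataP ζ' + X * C (1 / (e * h)) * dataQ ζ' b' c' = dataP ζ := by
  obtain ⟨hζ, hpos, hb, hc0, hc1⟩ := had
  have h0 : ∀ j, ζ j ≠ 0 := fun j => (hpos j).ne'
  have hcnn : 0 ≤ c := by
    rcases Nat.even_or_odd (n + 1) with h | h
    · exact (hc0 h).ge
    · exact (hc1 h).le
  -- With W the Weyl function, W(s) - W(e) = (e - s) ∑ β_j / (s + ζ_j), and h below is W(e). The
  -- factor e - s thus cancels without polynomial division.
  set β : Fin ((n + 1) / 2) → ℝ := fun j => b j / (ζ j + e) with hβ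
  have hβpos : ∀ j, 0 < β j := fun j => div_pos (hb j) (add_pos (hpos j) he)
  have hβb : ∀ j, b j = β j * (ζ j + e) := fun j => by
    rw [hβ]
    have := (add_pos (hpos j) he).ne'
    field_simp
  set h := c + ∑ j, β j with hh
  have hβζ : ∀ j, 0 < β j * ζ j := fun j => mul_pos (hβpos j) (hpos j)
  -- If c is not positive, then n + 1 is even and there is at least one pole; this keeps the sums
  -- below strictly positive.
  have hcK : 0 < c ∨ 0 < (n + 1) / 2 := by
    rcases Nat.even_or_odd (n + 1) with h | h
    · obtain ⟨l, hl⟩ := h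
      right
      lia
    · exact Or.inl (hc1 h)
  have hsumpos : ∀ f : Fin ((n + 1) / 2) → ℝ, (∀ j, 0 < f j) → 0 < c + ∑ j, f j := by
    intro f hf
    rcases hcK with h | h
    · exact add_pos_of_pos_of_nonneg h (Finset.sum_nonneg fun j _ => (hf j).le)
    · exact add_pos_of_nonneg_of_pos hcnn
        (Finset.sum_pos (fun j _ => hf j) ⟨⟨0, h⟩, Finset.mem_univ _⟩)
  have hhpos : 0 < h := hsumpos β hβpos
  -- With P = `dataP ζ` and Q = `dataQ ζ b c`, `ph` and `qh` are h times the reduced p and q, that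
  -- is, h (P - s Q / (e h)) and h (Q - h P) divided by 1 - s/e.
  set ph := dataQ ζ (fun j => β j * ζ j) c with hph
  set A := ∑ j, C (β j) * dataN ζ j with hA
  set qh := C (h * e) * A with hqh
  have hNX : ∀ j, X * dataN ζ j + C (ζ j) * dataN ζ j = dataP ζ := fun j => by
    rw [dataP_eq_mul_dataN ζ j]; ring
  -- the algebraic identities of the Darboux type step
  have id1 : ph + X * A = C h * dataP ζ := by
    rw [hph, hA, dataQ, hh, C_add, map_sum, add_mul, Finset.sum_mul, add_assoc, Finset.mul_sum,
      ← Finset.sum_add_distrib]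
    congr 1
    refine Finset.sum_congr rfl fun j _ => ?_
    rw [← hNX j, C_mul]
    ring
  have id2 : qh + C h * ph = C h * dataQ ζ b c := by
    rw [hqh, hph, hA, dataQ, dataQ, C_mul, mul_assoc, ← mul_add, add_comm, add_assoc,
      Finset.mul_sum, ← Finset.sum_add_distrib]
    congr 2
    refine Finset.sum_congr rfl fun j _ => ?_
    rw [hβb j]
    simp only [C_mul, C_add]
    ring
  have hprod : 0 < ∏ j, (ζ j)⁻¹ := Finset.prod_pos fun j _ => inv_pos.2 (hpos j)
  have hphdeg : ph.natDegree ≤ (n + 1) / 2 := natDegree_dataQ_le _ _ _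
  have hAdeg : A.natDegree ≤ (n + 1) / 2 - 1 := natDegree_sum_le_of_forall_le _ _ fun j _ =>
    (natDegree_C_mul_le _ _).trans (natDegree_dataN_le ζ j)
  have hqhdeg : qh.natDegree ≤ (n + 1) / 2 - 1 := (natDegree_C_mul_le _ _).trans hAdeg
  -- degrees and top coefficients
  have htop : ph.natDegree ≤ n / 2 ∧ 0 < ph.coeff (n / 2) ∧
      (Even n → qh.coeff (n / 2) = 0) ∧ (Odd n → 0 < qh.coeff (n / 2)) := by
    rcases Nat.even_or_odd n with hn | hn
    · obtain ⟨l, rfl⟩ := hn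
      have hl : (l + l + 1) / 2 = (l + l) / 2 := by lia
      refine ⟨hl ▸ hphdeg, ?_, fun _ => ?_, fun hodd => absurd hodd (by simp)⟩
      · rw [← hl, hph, coeff_dataQ]
        exact mul_pos (hc1 ⟨l, by ring⟩) hprod
      · rw [← hl, hqh, hA, coeff_C_mul, finsetSum_coeff]
        simp [coeff_dataN_eq_zero]
    · have hev : Even (n + 1) := hn.add_one
      have hc : c = 0 := hc0 hev
      obtain ⟨l, rfl⟩ := hn
      have hl : (2 * l + 1) / 2 = (2 * l + 1 + 1) / 2 - 1 := by lia
      have hne : (Finset.univ : Finset (Fin ((2 * l + 1 + 1) / 2))).Nonempty :=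
        ⟨⟨0, by lia⟩, Finset.mem_univ _⟩
      refine ⟨?_, ?_, fun hev => absurd hev (by simp), fun _ => ?_⟩
      · rw [hl, hph, dataQ, hc, C_0, zero_mul, zero_add]
        exact natDegree_sum_le_of_forall_le _ _ fun j _ =>
          (natDegree_C_mul_le _ _).trans (natDegree_dataN_le ζ j)
      · rw [hl, hph, dataQ, hc, C_0, zero_mul, zero_add, finsetSum_coeff]
        refine Finset.sum_pos (fun j _ => ?_) hne
        rw [coeff_C_mul, coeff_dataN]
        exact mul_pos (hβζ j) hprod
      · rw [hl, hqh, hA, coeff_C_mul, finsetSum_coeff]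
        refine mul_pos (mul_pos hhpos he) (Finset.sum_pos (fun j _ => ?_) hne)
        rw [coeff_C_mul, coeff_dataN]
        exact mul_pos (hβpos j) hprod
  obtain ⟨ht1, ht2, ht3, ht4⟩ := htop
  have hphdeg' : ph.natDegree = n / 2 := le_antisymm ht1 (le_natDegree_of_ne_zero ht2.ne')
  have hphroot : ∀ j, ph.eval (-ζ j) ≠ 0 := fun j => by
    rw [hph, eval_dataQ_root]
    exact mul_ne_zero (hβζ j).ne' (eval_dataN_self_ne_zero hζ.injective h0 j)
  have hroot : ∀ z : ℂ, aeval z ph = 0 → z.im = 0 ∧ z.re < 0 ∧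
      0 < qh.eval z.re * ph.derivative.eval z.re := by
    intro z hz
    have hPz : aeval z (dataP ζ) ≠ 0 := by
      intro hP
      obtain ⟨j, rfl⟩ := (aeval_dataP_eq_zero_iff h0 z).1 hP
      refine hphroot j (eval_eq_zero_of_aeval ?_)
      simpa using hz
    have hB := aeval_dataQ (fun j => β j * ζ j) c hPz
    rw [← hph, hz, eq_comm, mul_eq_zero, or_iff_right hPz] at hB
    have hzj : ∀ j, z + ζ j ≠ 0 := fun j hj =>
      hPz ((aeval_dataP_eq_zero_iff h0 z).2 ⟨j, eq_neg_of_add_eq_zero_left hj⟩)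
    -- Every term has as imaginary part a positive multiple of -z.im, so no cancellation is possible
    -- off the real line.
    have him : z.im = 0 := by
      have h1 := congrArg Complex.im hB
      rw [Complex.add_im, Complex.ofReal_im, zero_add, Complex.im_sum, Complex.zero_im] at h1
      have h2 : ∀ j, ((((β j * ζ j : ℝ) : ℂ)) / (z + ζ j)).im =
          -z.im * (β j * ζ j / Complex.normSq (z + ζ j)) := fun j => by
        rw [Complex.div_im]; simp; ring
      rw [Finset.sum_congr rfl fun j _ => h2 j, ← Finset.mul_sum, mul_eq_zero] at h1
      rcases h1 with h1 | h1
      · linarith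
      · exfalso
        have hterm : ∀ j, 0 < β j * ζ j / Complex.normSq (z + ζ j) := fun j =>
          div_pos (hβζ j) (Complex.normSq_pos.2 (hzj j))
        rcases Nat.eq_zero_or_pos ((n + 1) / 2) with hK | hK
        · have hc : 0 < c := hcK.resolve_right (by lia)
          have : IsEmpty (Fin ((n + 1) / 2)) := by rw [hK]; infer_instance
          simp only [Finset.univ_eq_empty, Finset.sum_empty, add_zero] at hB
          exact hc.ne' (by exact_mod_cast hB)
        · exact (Finset.sum_pos (fun j _ => hterm j) ⟨⟨0, hK⟩, Finset.mem_univ _⟩).ne' h1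
    have hzr : ((z.re : ℝ) : ℂ) = z := by apply Complex.ext <;> simp [him]
    generalize z.re = r at hzr
    subst hzr
    have hr : ph.eval r = 0 := eval_eq_zero_of_aeval hz
    have hrneg : r < 0 := by
      by_contra hr0
      rw [not_lt] at hr0
      rw [hph, eval_dataQ _ _ hpos hr0, mul_eq_zero, or_iff_right (eval_dataP_pos hpos hr0).ne'] at hr
      refine (hsumpos (fun j => β j * ζ j / (r + ζ j)) fun j => ?_).ne' hr
      exact div_pos (hβζ j) (by have := hpos j; positivity)
    have hrj : ∀ j, r + ζ j ≠ 0 := fun j => by have := hzj j; exact_mod_cast this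
    have hPr : (dataP ζ).eval r ≠ 0 := by
      simp only [dataP, eval_mul, eval_C, eval_prod, eval_add, eval_X]
      exact mul_ne_zero hprod.ne' (Finset.prod_ne_zero_iff.2 fun j _ => hrj j)
    refine ⟨him, hrneg, ?_⟩
    have hNr : ∀ j, (dataN ζ j).eval r = (dataP ζ).eval r / (r + ζ j) := fun j => by
      rw [dataP_eq_mul_dataN ζ j]
      have := hrj j
      simp only [eval_mul, eval_add, eval_X, eval_C]
      field_simp
    have hdN : ∀ j, (dataN ζ j).derivative.eval r =
        ((dataP ζ).derivative.eval r - (dataN ζ j).eval r) / (r + ζ j) := fun j => by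
      have h1 := congrArg (fun f => f.derivative.eval r) (dataP_eq_mul_dataN ζ j)
      simp at h1
      have := hrj j
      rw [eq_div_iff this, h1]
      ring
    have hrne := hrneg.ne
    have hid := congrArg (eval r) id1
    simp only [eval_add, eval_mul, eval_X, eval_C, hr, zero_add] at hid
    -- At a zero of `ph`, `id1` gives A(r) = h P(r) / r; as r < 0, its sign is opposite to that of
    -- P(r), and so is the sign of ph'(r) computed below.
    have hqr : qh.eval r = h * e * (h * (dataP ζ).eval r / r) := by
      rw [← hid, hqh, eval_mul, eval_C]
      field_simp
    -- the logarithmic derivative of `ph / dataP` at the zero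
    have hBr : c + ∑ j, β j * ζ j / (r + ζ j) = 0 := by exact_mod_cast hB
    have hder : ph.derivative.eval r =
        -((dataP ζ).eval r) * ∑ j, β j * ζ j / (r + ζ j) ^ 2 := by
      have h1 : ph.derivative.eval r = c * (dataP ζ).derivative.eval r +
          ∑ j, β j * ζ j * (dataN ζ j).derivative.eval r := by
        rw [hph, dataQ]
        simp [eval_finsetSum, mul_assoc]
      have h2 : ∀ j, β j * ζ j * (dataN ζ j).derivative.eval r =
          (dataP ζ).derivative.eval r * (β j * ζ j / (r + ζ j)) -
            (dataP ζ).eval r * (β j * ζ j / (r + ζ j) ^ 2) := fun j => by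
        rw [hdN, hNr]
        have := hrj j
        field_simp
      rw [h1, Finset.sum_congr rfl fun j _ => h2 j, Finset.sum_sub_distrib, ← Finset.mul_sum,
        ← Finset.mul_sum]
      linear_combination (dataP ζ).derivative.eval r * hBr
    have hKpos : 0 < (n + 1) / 2 := by
      rcases Nat.eq_zero_or_pos ((n + 1) / 2) with hK | hK
      · exfalso
        have hc : 0 < c := hcK.resolve_right (by lia)
        have : IsEmpty (Fin ((n + 1) / 2)) := by rw [hK]; infer_instance
        simp only [Finset.univ_eq_empty, Finset.sum_empty, add_zero] at hBr
        exact hc.ne' hBr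
      · exact hK
    have hS : 0 < ∑ j, β j * ζ j / (r + ζ j) ^ 2 :=
      Finset.sum_pos (fun j _ => div_pos (hβζ j) (by have := hrj j; positivity))
        ⟨⟨0, hKpos⟩, Finset.mem_univ _⟩
    rw [hqr, hder]
    have : h * e * (h * (dataP ζ).eval r / r) *
        (-((dataP ζ).eval r) * ∑ j, β j * ζ j / (r + ζ j) ^ 2) =
        h ^ 2 * e * (dataP ζ).eval r ^ 2 * (∑ j, β j * ζ j / (r + ζ j) ^ 2) / (-r) := by
      have := hrneg.ne
      field_simp
    rw [this]
    have : 0 < -r := by linarith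
    positivity
  obtain ⟨ζ', b', hζ', hpos', hb', hp, hq⟩ := exists_data hphdeg'
    (fun h => by simp [h] at ht2) (hqhdeg.trans (by lia)) hroot
  have hph0 : ph.eval 0 = h := by
    have := congrArg (eval 0) id1
    simpa [eval_zero_dataP h0] using this
  rw [hph0] at hp hq
  have hCh : C h ≠ 0 := C_ne_zero.2 hhpos.ne'
  refine ⟨ζ', b', qh.coeff (n / 2) / ph.coeff (n / 2), h, ⟨hζ', hpos', hb', fun hn => ?_, fun hn => ?_⟩, hhpos,
    mul_left_cancel₀ hCh ?_, mul_left_cancel₀ hCh ?_⟩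
  · rw [ht3 hn, zero_div]
  · exact div_pos (ht4 hn) ht2
  · rw [← id2, mul_add, ← hq, mul_left_comm, ← hp]
  · rw [← id1, mul_add, ← hp, mul_left_comm, ← hq, hqh]
    congr 1
    have : C (1 / (e * h)) * C (h * e) = (1 : ℝ[X]) := by
      rw [← C_mul, ← C_1]
      congr 1
      field_simp
    linear_combination (X * A) * this

/-- The inverse spectral problem is solvable. -/
lemma exists_positions {m : ℕ → ℝ} (hm : ∀ k, 0 < m k) (n : ℕ) (ζ b : Fin (n / 2) → ℝ) (c : ℝ)
    (had : IsAdmissible n ζ b c) : ∃ x : ℕ → ℝ, SpectralPoly n m x ζ b c := by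
  induction n generalizing c with
  | zero =>
    refine ⟨0, ?_, ?_⟩
    · simp [dataQ, had.shift_even]
    · simp [dataP]
  | succ n ih =>
    have he : 0 < 1 / m n ^ 2 := by have := hm n; positivity
    obtain ⟨ζ', b', c', h, had', hh, h1, h2⟩ := exists_reduced_data had he
    obtain ⟨x, hx1, hx2⟩ := ih ζ' b' c' had'
    -- Chosen so that m_n e^{x_n} = h; then m_n e^{-x_n} = m_n² / h, which is the coefficient 1 / (e
    -- h) at e = 1 / m_n².
    refine ⟨Function.update x n (Real.log (h / m n)), ?_⟩
    have hhm : 0 < h / m n := div_pos hh (hm n)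
    have hmn := (hm n).ne'
    have hhn : hSeq m (Function.update x n (Real.log (h / m n))) n = h := by
      rw [hSeq, Function.update_self, Real.exp_log hhm]
      field_simp
    have hgn : gSeq m (Function.update x n (Real.log (h / m n))) n = 1 / (1 / m n ^ 2 * h) := by
      rw [gSeq, Function.update_self, Real.exp_neg, Real.exp_log hhm]
      field_simp
    obtain ⟨e1, e2⟩ := bvp_congr (n := n)
      (h := hSeq m (Function.update x n (Real.log (h / m n)))) (h' := hSeq m x)
      (g := gSeq m (Function.update x n (Real.log (h / m n)))) (g' := gSeq m x)
      (fun k hk => by rw [hSeq, hSeq, Function.update_of_ne hk.ne])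
      (fun k hk => by rw [gSeq, gSeq, Function.update_of_ne hk.ne])
    rw [SpectralPoly, qPoly_succ, pPoly_succ, e1, e2, hx1, hx2, hhn, hgn]
    exact ⟨h1, h2⟩

/-! ### Uniqueness and continuity of the positions -/

/-- Step k is singular at its own node, so h_k is read off the polynomials of index k + 1; p has no
zero on s ≥ 0. -/
lemma hSeq_eq_of_node {m x : ℕ → ℝ} (hm : ∀ k, 0 < m k) (k : ℕ) :
    hSeq m x k = (qPoly (hSeq m x) (gSeq m x) (k + 1)).eval (1 / m k ^ 2) /
      (pPoly (hSeq m x) (gSeq m x) (k + 1)).eval (1 / m k ^ 2) := by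
  have hmk := (hm k).ne'
  rw [eq_div_iff (eval_bvp_nonneg (hSeq_pos hm x) (gSeq_pos hm x) (by positivity) _).2.ne']
  refine (eval_qPoly_succ_of_node ?_).symm
  rw [hSeq_mul_gSeq]
  field_simp

lemma eq_log_hSeq {m : ℕ → ℝ} (x : ℕ → ℝ) {k : ℕ} (hm : 0 < m k) :
    x k = Real.log (hSeq m x k / m k) := by
  rw [hSeq, mul_div_cancel_left₀ _ hm.ne', Real.log_exp]

/-- The positions are determined by the polynomials `q_n` and `p_n`. -/
lemma positions_unique {m x x' : ℕ → ℝ} (hm : ∀ k, 0 < m k) {n : ℕ}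
    (hq : qPoly (hSeq m x) (gSeq m x) n = qPoly (hSeq m x') (gSeq m x') n)
    (hp : pPoly (hSeq m x) (gSeq m x) n = pPoly (hSeq m x') (gSeq m x') n) :
    ∀ k < n, x k = x' k := by
  induction n with
  | zero => intro k hk; lia
  | succ n ih =>
    have hn : x n = x' n := by
      rw [eq_log_hSeq x (hm n), eq_log_hSeq x' (hm n), hSeq_eq_of_node hm, hq, hp,
        ← hSeq_eq_of_node hm]
    have hh : hSeq m x n = hSeq m x' n := by rw [hSeq, hSeq, hn]
    have hg : gSeq m x n = gSeq m x' n := by rw [gSeq, gSeq, hn]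
    have hdet : (1 - C (m n ^ 2) * X : ℝ[X]) ≠ 0 := fun h => by
      have := congrArg (eval 0) h
      simp at this
    obtain ⟨b1, b2⟩ := bvp_backward (h := hSeq m x) (g := gSeq m x) n
    obtain ⟨b1', b2'⟩ := bvp_backward (h := hSeq m x') (g := gSeq m x') n
    rw [hSeq_mul_gSeq] at b1 b2 b1' b2'
    have ih' := ih (mul_left_cancel₀ hdet (by rw [b1, b1', hq, hp, hh]))
      (mul_left_cancel₀ hdet (by rw [b2, b2', hq, hp, hg]))
    intro k hk
    rcases Nat.lt_succ_iff_lt_or_eq.1 hk with hk | rfl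
    · exact ih' k hk
    · exact hn

/-- The backward step divides by 1 - m_i² s. Convergence is therefore followed only at points s
where no such factor vanishes, and these points accumulate everywhere. -/
lemma eventually_generic (m : ℕ → ℝ) (n : ℕ) (e : ℝ) :
    ∀ᶠ s in 𝓝[≠] e, ∀ i < n, s * m i ^ 2 ≠ 1 := by
  have : ∀ i ∈ Finset.range n, ∀ᶠ s in 𝓝[≠] e, s * m i ^ 2 ≠ 1 := by
    intro i _
    by_cases h : e * m i ^ 2 = 1
    · filter_upwards [self_mem_nhdsWithin] with s hs h'
      have : m i ^ 2 ≠ 0 := right_ne_zero_of_mul (h ▸ one_ne_zero)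
      exact hs (mul_right_cancel₀ this (h'.trans h.symm))
    · refine nhdsWithin_le_nhds ?_
      have : ContinuousAt (fun s : ℝ => s * m i ^ 2) e := by fun_prop
      exact this.eventually_ne h
  filter_upwards [(Finset.eventually_all _).2 this] with s hs i hi
  exact hs i (Finset.mem_range.2 hi)

/-- If `q_n` and `p_n` are kept fixed, the positions depend continuously on the masses. -/
lemma tendsto_positions {ι : Type*} {l : Filter ι} {m x : ℕ → ℝ} {m' x' : ι → ℕ → ℝ} {n : ℕ}
    (hm : ∀ k, 0 < m k) (hm' : ∀ᶠ i in l, ∀ k, 0 < m' i k)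
    (hlim : ∀ k < n, Tendsto (fun i => m' i k) l (𝓝 (m k)))
    (hq : ∀ᶠ i in l, qPoly (hSeq (m' i) (x' i)) (gSeq (m' i) (x' i)) n =
      qPoly (hSeq m x) (gSeq m x) n)
    (hp : ∀ᶠ i in l, pPoly (hSeq (m' i) (x' i)) (gSeq (m' i) (x' i)) n =
      pPoly (hSeq m x) (gSeq m x) n) :
    ∀ k < n, Tendsto (fun i => x' i k) l (𝓝 (x k)) := by
  -- Downward induction on the number of remaining particles: pointwise convergence of the
  -- polynomials at generic s, together with convergence of the positions already peeled off.
  have key : ∀ j ≤ n,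
      (∀ s : ℝ, (∀ i < n, s * m i ^ 2 ≠ 1) →
        Tendsto (fun i => (qPoly (hSeq (m' i) (x' i)) (gSeq (m' i) (x' i)) (n - j)).eval s) l
          (𝓝 ((qPoly (hSeq m x) (gSeq m x) (n - j)).eval s)) ∧
        Tendsto (fun i => (pPoly (hSeq (m' i) (x' i)) (gSeq (m' i) (x' i)) (n - j)).eval s) l
          (𝓝 ((pPoly (hSeq m x) (gSeq m x) (n - j)).eval s))) ∧
      ∀ k < n, n - j ≤ k → Tendsto (fun i => x' i k) l (𝓝 (x k)) := by
    intro j hj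
    induction j with
    | zero =>
      refine ⟨fun s _ => ⟨?_, ?_⟩, fun k hk hk' => by lia⟩
      · exact tendsto_const_nhds.congr' (hq.mono fun i hi => by simp only [Nat.sub_zero, hi])
      · exact tendsto_const_nhds.congr' (hp.mono fun i hi => by simp only [Nat.sub_zero, hi])
    | succ j ih =>
      obtain ⟨ih1, ih2⟩ := ih (by lia)
      obtain ⟨k, hk, hkn⟩ : ∃ k, n - j = k + 1 ∧ n - (j + 1) = k := ⟨n - (j + 1), by lia, rfl⟩
      rw [hk] at ih1 ih2
      rw [hkn]
      have hkn' : k < n := by lia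
      have hmk := hm k
      have hmk' := hlim k hkn'
      have he : 0 < 1 / m k ^ 2 := by positivity
      have he' : Tendsto (fun i => 1 / m' i k ^ 2) l (𝓝 (1 / m k ^ 2)) :=
        tendsto_const_nhds.div (hmk'.pow 2) (by positivity)
      have hgen := eventually_generic m n (1 / m k ^ 2)
      have hWc : ContinuousAt (fun s => (qPoly (hSeq m x) (gSeq m x) (k + 1)).eval s /
          (pPoly (hSeq m x) (gSeq m x) (k + 1)).eval s) (1 / m k ^ 2) :=
        (Polynomial.continuous _).continuousAt.div (Polynomial.continuous _).continuousAt
          (eval_bvp_nonneg (hSeq_pos hm x) (gSeq_pos hm x) he.le _).2.ne'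
      have hW : ∀ s : ℝ, 0 ≤ s → (∀ i < n, s * m i ^ 2 ≠ 1) →
          Tendsto (fun i => (qPoly (hSeq (m' i) (x' i)) (gSeq (m' i) (x' i)) (k + 1)).eval s /
            (pPoly (hSeq (m' i) (x' i)) (gSeq (m' i) (x' i)) (k + 1)).eval s) l
            (𝓝 ((qPoly (hSeq m x) (gSeq m x) (k + 1)).eval s /
              (pPoly (hSeq m x) (gSeq m x) (k + 1)).eval s)) := fun s hs hs' =>
        (ih1 s hs').1.div (ih1 s hs').2
          (eval_bvp_nonneg (hSeq_pos hm x) (gSeq_pos hm x) hs _).2.ne'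
      have hmono : ∀ i, (∀ k, 0 < m' i k) → ∀ s t : ℝ, 0 ≤ s → s ≤ t →
          (qPoly (hSeq (m' i) (x' i)) (gSeq (m' i) (x' i)) (k + 1)).eval t /
            (pPoly (hSeq (m' i) (x' i)) (gSeq (m' i) (x' i)) (k + 1)).eval t ≤
          (qPoly (hSeq (m' i) (x' i)) (gSeq (m' i) (x' i)) (k + 1)).eval s /
            (pPoly (hSeq (m' i) (x' i)) (gSeq (m' i) (x' i)) (k + 1)).eval s := by
        intro i hi s t hs hst
        have hh := hSeq_pos hi (x' i)
        have hg := gSeq_pos hi (x' i)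
        rw [div_le_div_iff₀ (eval_bvp_nonneg hh hg (hs.trans hst) _).2
          (eval_bvp_nonneg hh hg hs _).2]
        exact (bvp_two_point hh hg hs hst _).1
      -- h_k is the quotient q/p at a node that itself moves, and convergence is known only at fixed
      -- generic points. Since q/p decreases, its value at the moving node is squeezed between
      -- values at generic points on either side of the limit node.
      have hh : Tendsto (fun i => hSeq (m' i) (x' i) k) l (𝓝 (hSeq m x k)) := by
        rw [tendsto_order]
        rw [hSeq_eq_of_node hm]
        refine ⟨fun a ha => ?_, fun a ha => ?_⟩
        · have hev : ∀ᶠ s in 𝓝[>] (1 / m k ^ 2), a <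
              (qPoly (hSeq m x) (gSeq m x) (k + 1)).eval s /
                (pPoly (hSeq m x) (gSeq m x) (k + 1)).eval s :=
            nhdsWithin_le_nhds (hWc.eventually_const_lt ha)
          have hgen' : ∀ᶠ s in 𝓝[>] (1 / m k ^ 2), ∀ i < n, s * m i ^ 2 ≠ 1 :=
            nhdsWithin_mono _ (fun s hs => ne_of_gt hs) hgen
          obtain ⟨s, hs1, hs2, hs3⟩ := (hev.and (hgen'.and self_mem_nhdsWithin)).exists
          have hs0 : 0 ≤ s := he.le.trans (le_of_lt hs3)
          filter_upwards [(hW s hs0 hs2).eventually_const_lt hs1, hm', he'.eventually_lt_const hs3]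
            with i h1 h2 h3
          rw [hSeq_eq_of_node h2]
          exact h1.trans_le (hmono i h2 _ _ (by have := h2 k; positivity) h3.le)
        · have hev : ∀ᶠ s in 𝓝[<] (1 / m k ^ 2),
              (qPoly (hSeq m x) (gSeq m x) (k + 1)).eval s /
                (pPoly (hSeq m x) (gSeq m x) (k + 1)).eval s < a ∧ 0 < s :=
            nhdsWithin_le_nhds ((hWc.eventually_lt_const ha).and (lt_mem_nhds he))
          have hgen' : ∀ᶠ s in 𝓝[<] (1 / m k ^ 2), ∀ i < n, s * m i ^ 2 ≠ 1 :=
            nhdsWithin_mono _ (fun s hs => ne_of_lt hs) hgen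
          obtain ⟨s, ⟨hs1, hs0⟩, hs2, hs3⟩ := (hev.and (hgen'.and self_mem_nhdsWithin)).exists
          filter_upwards [(hW s hs0.le hs2).eventually_lt_const hs1, hm',
            he'.eventually_const_lt hs3] with i h1 h2 h3
          rw [hSeq_eq_of_node h2]
          exact (hmono i h2 _ _ hs0.le h3.le).trans_lt h1
      have hx : Tendsto (fun i => x' i k) l (𝓝 (x k)) := by
        rw [eq_log_hSeq x hmk]
        refine ((hh.div hmk' hmk.ne').log (div_pos (hSeq_pos hm x k) hmk).ne').congr' ?_
        filter_upwards [hm'] with i hi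
        exact (eq_log_hSeq (x' i) (hi k)).symm
      have hg : Tendsto (fun i => gSeq (m' i) (x' i) k) l (𝓝 (gSeq m x k)) :=
        hmk'.mul ((Real.continuous_exp.tendsto _).comp hx.neg)
      refine ⟨fun s hs => ?_, fun i hi hki => ?_⟩
      · have hdet : 1 - m k ^ 2 * s ≠ 0 := fun h => hs k hkn' (by linarith)
        have hdet' : Tendsto (fun i => 1 - m' i k ^ 2 * s) l (𝓝 (1 - m k ^ 2 * s)) :=
          tendsto_const_nhds.sub ((hmk'.pow 2).mul_const s)
        have hback : ∀ m x : ℕ → ℝ, 1 - m k ^ 2 * s ≠ 0 →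
            (qPoly (hSeq m x) (gSeq m x) k).eval s =
              ((qPoly (hSeq m x) (gSeq m x) (k + 1)).eval s -
                hSeq m x k * (pPoly (hSeq m x) (gSeq m x) (k + 1)).eval s) / (1 - m k ^ 2 * s) ∧
            (pPoly (hSeq m x) (gSeq m x) k).eval s =
              ((pPoly (hSeq m x) (gSeq m x) (k + 1)).eval s -
                gSeq m x k * s * (qPoly (hSeq m x) (gSeq m x) (k + 1)).eval s) /
                  (1 - m k ^ 2 * s) := by
          intro m x hd
          obtain ⟨b1, b2⟩ := bvp_backward (h := hSeq m x) (g := gSeq m x) k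
          rw [hSeq_mul_gSeq] at b1 b2
          have b1 := congrArg (eval s) b1
          have b2 := congrArg (eval s) b2
          simp only [eval_mul, eval_sub, eval_one, eval_C, eval_X] at b1 b2
          rw [eq_div_iff hd, eq_div_iff hd]
          constructor <;> linarith
        rw [(hback m x hdet).1, (hback m x hdet).2]
        have hev := hdet'.eventually_ne hdet
        obtain ⟨t1, t2⟩ := ih1 s hs
        exact ⟨((t1.sub (hh.mul t2)).div hdet' hdet).congr'
            (hev.mono fun i hi => (hback (m' i) (x' i) hi).1.symm),
          ((t2.sub ((hg.mul_const s).mul t1)).div hdet' hdet).congr'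
            (hev.mono fun i hi => (hback (m' i) (x' i) hi).2.symm)⟩
      · rcases hki.eq_or_lt with rfl | hki
        · exact hx
        · exact ih2 i hi hki
  intro k hk
  exact (key n le_rfl).2 k hk (by lia)

/-! ### Finite sequences -/

/-- Extension of a finite sequence to all indices by a constant. -/
def extSeq {n : ℕ} (d : ℝ) (f : Fin n → ℝ) (k : ℕ) : ℝ := if hk : k < n then f ⟨k, hk⟩ else d

@[simp] lemma extSeq_coe {n : ℕ} (d : ℝ) (f : Fin n → ℝ) (k : Fin n) : extSeq d f k = f k := by
  simp [extSeq]

lemma extSeq_of_lt {n : ℕ} (d : ℝ) (f : Fin n → ℝ) {k : ℕ} (hk : k < n) :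
    extSeq d f k = f ⟨k, hk⟩ := by
  simp [extSeq, hk]

/-- The default mass is 1, not 0, so that positivity holds at all indices; the entries beyond n do
not enter the polynomials of index n. -/
lemma extSeq_one_pos {n : ℕ} {m : Fin n → ℝ} (hm : ∀ j, 0 < m j) (k : ℕ) : 0 < extSeq 1 m k := by
  rw [extSeq]
  split_ifs
  · exact hm _
  · exact one_pos

/-- Spectral data in polynomial form for finitely many particles. -/
def FinSpectral {n : ℕ} (m x : Fin n → ℝ) (ζ b : Fin (n / 2) → ℝ) (c : ℝ) : Prop :=
  SpectralPoly n (extSeq 1 m) (extSeq 0 x) ζ b c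

lemma qp_eq {n : ℕ} (m x : Fin n → ℝ) (z : ℂ) (k : Fin (n + 1)) :
    qp m x z k =
      (aeval (-z) (qPoly (hSeq (extSeq 1 m) (extSeq 0 x)) (gSeq (extSeq 1 m) (extSeq 0 x)) k),
        aeval (-z) (pPoly (hSeq (extSeq 1 m) (extSeq 0 x)) (gSeq (extSeq 1 m) (extSeq 0 x)) k)) := by
  induction k using Fin.induction with
  | zero => simp [qp]
  | succ k ih =>
    have : qp m x z k.succ = ((qp m x z k.castSucc).1 +
        ((m k * Real.exp (x k) : ℝ) : ℂ) * (qp m x z k.castSucc).2,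
        (qp m x z k.castSucc).2 -
          z * ((m k * Real.exp (-x k) : ℝ) : ℂ) * (qp m x z k.castSucc).1) := by
      simp only [qp, Fin.induction_succ]
    rw [this, ih, Fin.val_succ, aeval_qPoly_succ, aeval_pPoly_succ, hSeq, gSeq]
    simp only [Fin.val_castSucc, extSeq_coe]
    ext <;> simp
    ring

lemma FinSpectral.hasSpectralData {n : ℕ} {m x : Fin n → ℝ} {ζ b : Fin (n / 2) → ℝ} {c : ℝ}
    (h : FinSpectral m x ζ b c) (h0 : ∀ j, 0 < ζ j) : HasSpectralData m x ζ b c := by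
  intro z
  rw [qp_eq, Fin.val_last, h.1, h.2]
  refine ⟨?_, fun hz => ?_⟩
  · rw [aeval_dataP_eq_zero_iff fun j => (h0 j).ne']
    simp
  · rw [div_eq_iff hz, aeval_dataQ b c hz, mul_comm]
    simp only [neg_add_eq_sub]

lemma exists_finSpectral {n : ℕ} {m : Fin n → ℝ} (hm : ∀ j, 0 < m j) {ζ b : Fin (n / 2) → ℝ}
    {c : ℝ} (had : IsAdmissible n ζ b c) : ∃ x : Fin n → ℝ, FinSpectral m x ζ b c := by
  obtain ⟨x, hx⟩ := exists_positions (extSeq_one_pos hm) n ζ b c had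
  refine ⟨fun k => x k, ?_⟩
  obtain ⟨e1, e2⟩ := bvp_congr (n := n) (h := hSeq (extSeq 1 m) (extSeq 0 fun k : Fin n => x k))
    (h' := hSeq (extSeq 1 m) x) (g := gSeq (extSeq 1 m) (extSeq 0 fun k : Fin n => x k))
    (g' := gSeq (extSeq 1 m) x)
    (fun k hk => by rw [hSeq, hSeq, extSeq_of_lt 0 _ hk])
    (fun k hk => by rw [gSeq, gSeq, extSeq_of_lt 0 _ hk])
  exact ⟨e1.trans hx.1, e2.trans hx.2⟩

lemma FinSpectral.unique {n : ℕ} {m x x' : Fin n → ℝ} (hm : ∀ j, 0 < m j)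
    {ζ b : Fin (n / 2) → ℝ} {c : ℝ} (h : FinSpectral m x ζ b c) (h' : FinSpectral m x' ζ b c) :
    x = x' := by
  ext k
  have := positions_unique (extSeq_one_pos hm) (h.1.trans h'.1.symm) (h.2.trans h'.2.symm) k k.2
  simpa using this

/-! ### The determinantal formulas -/

/-- The determinant of the first `k` backward transition matrices. -/
def detPoly (H G : ℕ → ℝ) (k : ℕ) : ℝ[X] := ∏ j ∈ Finset.range k, (1 - C (H j * G j) * X)

lemma detPoly_ne_zero (H G : ℕ → ℝ) (k : ℕ) : detPoly H G k ≠ 0 :=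
  Finset.prod_ne_zero_iff.2 fun j _ h => by simpa using congrArg (eval 0) h

lemma eval_detPoly_of_node {H G : ℕ → ℝ} {k i : ℕ} (hi : i < k) {e : ℝ}
    (he : e * (H i * G i) = 1) : (detPoly H G k).eval e = 0 := by
  rw [detPoly, eval_prod]
  refine Finset.prod_eq_zero (Finset.mem_range.2 hi) ?_
  simp only [eval_sub, eval_one, eval_mul, eval_C, eval_X]
  linarith

/-- The entries `pPoly G H`, `-qPoly H G`, `-X * qPoly G H`, `pPoly H G` form the product of k
backward matrices, each of determinant 1 - H_j G_j s. -/
lemma det_bvp (H G : ℕ → ℝ) (k : ℕ) :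
    pPoly G H k * pPoly H G k - X * qPoly H G k * qPoly G H k = detPoly H G k := by
  induction k with
  | zero => simp [detPoly]
  | succ k ih =>
    rw [detPoly, Finset.prod_range_succ, ← detPoly, ← ih, pPoly_succ, pPoly_succ, qPoly_succ,
      qPoly_succ, C_mul]
    ring

/-- Peeling off `k` particles from the right. -/
lemma bvp_peel {h g H G : ℕ → ℝ} {n : ℕ} (hH : ∀ j < n, H j = h (n - 1 - j))
    (hG : ∀ j < n, G j = g (n - 1 - j)) {k : ℕ} (hk : k ≤ n) :
    pPoly G H k * qPoly h g n - qPoly H G k * pPoly h g n = detPoly H G k * qPoly h g (n - k) ∧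
    pPoly H G k * pPoly h g n - X * qPoly G H k * qPoly h g n =
      detPoly H G k * pPoly h g (n - k) := by
  induction k with
  | zero => simp [detPoly]
  | succ k ih =>
    obtain ⟨i1, i2⟩ := ih (by lia)
    obtain ⟨b1, b2⟩ := bvp_backward (h := h) (g := g) (n - (k + 1))
    rw [show n - (k + 1) + 1 = n - k by lia] at b1 b2
    have e1 := hH k (by lia)
    have e2 := hG k (by lia)
    rw [show n - 1 - k = n - (k + 1) by lia] at e1 e2
    rw [← e1, ← e2] at b1 b2
    rw [detPoly, Finset.prod_range_succ, ← detPoly, qPoly_succ, qPoly_succ, pPoly_succ,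
      pPoly_succ]
    constructor
    · linear_combination i1 - C (H k) * i2 - detPoly H G k * b1
    · linear_combination i2 - X * C (G k) * i1 - detPoly H G k * b2

lemma degree_mul_lt {p q : ℝ[X]} {A B : ℕ} (hp : p.degree < A) (hq : q.natDegree ≤ B) :
    (p * q).degree < (A + B : ℕ) := by
  by_cases h : p * q = 0
  · rw [h, degree_zero]
    exact WithBot.bot_lt_coe _
  · have hp0 := left_ne_zero_of_mul h
    have hq0 := right_ne_zero_of_mul h
    rw [← natDegree_lt_iff_degree_lt hp0] at hp
    rw [← natDegree_lt_iff_degree_lt h, natDegree_mul hp0 hq0]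
    lia

lemma coeff_sum_C_mul_X_pow (v : ℕ → ℝ) (l i : ℕ) :
    (∑ j ∈ Finset.range l, C (v j) * X ^ j).coeff i = if i < l then v i else 0 := by
  simp [finsetSum_coeff, coeff_C_mul, coeff_X_pow]

lemma degree_sum_C_mul_X_pow_lt (v : ℕ → ℝ) (l : ℕ) :
    (∑ j ∈ Finset.range l, C (v j) * X ^ j).degree < (l : WithBot ℕ) := by
  rw [degree_lt_iff_coeff_zero]
  intro i hi
  rw [coeff_sum_C_mul_X_pow, if_neg hi.not_gt]

/-- A vector is a pair of polynomials a, d with degrees below l and k - l, and the matrix evaluates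
s μ̂ a + d at the nodes. -/
lemma csv_mulVec {K k l : ℕ} (hl : l ≤ k) (e : Fin k → ℝ) (ζ b : Fin K → ℝ) (c : ℝ) (v : ℕ → ℝ)
    (i : Fin k) :
    (csv l 1 e ζ b c).mulVec (fun j => v j) i =
      e i * stieltjes ζ b c (e i) * ∑ j ∈ Finset.range l, v j * e i ^ j +
        ∑ j ∈ Finset.range (k - l), v (l + j) * e i ^ j := by
  have h1 : (csv l 1 e ζ b c).mulVec (fun j => v j) i = ∑ j ∈ Finset.range k,
      (if j < l then e i ^ (1 + j) * stieltjes ζ b c (e i) else e i ^ (j - l)) * v j := by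
    rw [← Fin.sum_univ_eq_sum_range
      (fun j => (if j < l then e i ^ (1 + j) * stieltjes ζ b c (e i) else e i ^ (j - l)) * v j)]
    rfl
  rw [h1]
  conv_lhs => rw [show k = l + (k - l) by lia]
  rw [Finset.sum_range_add, Finset.mul_sum]
  congr 1
  · refine Finset.sum_congr rfl fun j hj => ?_
    rw [if_pos (Finset.mem_range.1 hj)]
    ring
  · refine Finset.sum_congr rfl fun j _ => ?_
    rw [if_neg (by lia), Nat.add_sub_cancel_left, mul_comm]

section Determinant

variable {K k : ℕ} {H G : ℕ → ℝ} {e : Fin k → ℝ} {ζ b : Fin K → ℝ} {c : ℝ}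

/-- The Cauchy-Stieltjes-Vandermonde determinant in the denominators does not vanish. -/
lemma det_csv_one_ne_zero (he : Function.Injective e)
    (h1 : ∀ i, (pPoly G H k).eval (e i) * stieltjes ζ b c (e i) = (qPoly H G k).eval (e i))
    (h2 : ∀ i, e i * (qPoly G H k).eval (e i) * stieltjes ζ b c (e i) = (pPoly H G k).eval (e i)) :
    (csv (k / 2) 1 e ζ b c).det ≠ 0 := by
  intro hdet
  obtain ⟨v, hv0, hv⟩ := Matrix.exists_mulVec_eq_zero_iff.2 hdet
  refine hv0 ?_
  set l := k / 2 with hl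
  have hlk : l ≤ k := Nat.div_le_self _ _
  -- With truncated subtraction, the degree count for `f2` is off by one at k = 0.
  rcases Nat.eq_zero_or_pos k with hk | hk
  · subst hk
    exact Subsingleton.elim _ _
  set v' := extSeq 0 v with hv'
  have hvv : v = fun j : Fin k => v' j := by ext j; simp [hv']
  set a : ℝ[X] := ∑ j ∈ Finset.range l, C (v' j) * X ^ j with ha
  set d : ℝ[X] := ∑ j ∈ Finset.range (k - l), C (v' (l + j)) * X ^ j with hd
  have hrel : ∀ i, e i * stieltjes ζ b c (e i) * a.eval (e i) + d.eval (e i) = 0 := by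
    intro i
    have := congrFun hv i
    rw [hvv, csv_mulVec hlk] at this
    simpa [ha, hd, eval_finsetSum] using this
  have hadeg := degree_sum_C_mul_X_pow_lt v' l
  have hddeg := degree_sum_C_mul_X_pow_lt (fun j => v' (l + j)) (k - l)
  have hzero : ∀ f : ℝ[X], f.degree < k → (∀ i, f.eval (e i) = 0) → f = 0 := fun f hf hfe =>
    eq_zero_of_degree_lt_of_eval_index_eq_zero (s := Finset.univ) (v := e) he.injOn
      (by rwa [Finset.card_univ, Fintype.card_fin]) fun i _ => hfe i
  have hlt : ∀ (f : ℝ[X]) (N : ℕ), f.degree < N → N ≤ k → f.degree < k := fun f N h hN =>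
    h.trans_le (by exact_mod_cast hN)
  -- Eliminating μ̂ between the kernel relation and an interpolation condition leaves a polynomial
  -- of degree below k with k distinct zeros.
  have f1 : a * pPoly H G k + d * qPoly G H k = 0 := by
    refine hzero _ ((degree_add_le _ _).trans_lt (max_lt ?_ ?_)) fun i => ?_
    · exact hlt _ _ (degree_mul_lt hadeg (natDegree_pPoly_le k)) (by lia)
    · exact hlt _ _ (degree_mul_lt hddeg (natDegree_qPoly_le k)) (by lia)
    · rw [eval_add, eval_mul, eval_mul, ← h2]
      linear_combination (qPoly G H k).eval (e i) * hrel i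
  have f2 : a * (X * qPoly H G k) + d * pPoly G H k = 0 := by
    refine hzero _ ((degree_add_le _ _).trans_lt (max_lt ?_ ?_)) fun i => ?_
    · refine hlt _ _ (degree_mul_lt (B := 1 + (k - 1) / 2) hadeg
        (natDegree_mul_le.trans ?_)) (by lia)
      rw [natDegree_X]
      exact Nat.add_le_add_left (natDegree_qPoly_le k) 1
    · exact hlt _ _ (degree_mul_lt hddeg (natDegree_pPoly_le k)) (by lia)
    · rw [eval_add, eval_mul, eval_mul, eval_mul, eval_X, ← h1]
      linear_combination (pPoly G H k).eval (e i) * hrel i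
  have hD := det_bvp H G k
  -- `f1` and `f2` form a homogeneous linear system for (a, d) of determinant `detPoly H G k`, which
  -- is not 0.
  have ha0 : a = 0 := by
    refine (mul_eq_zero.1 ?_).resolve_right (detPoly_ne_zero H G k)
    rw [← hD]
    linear_combination pPoly G H k * f1 - qPoly G H k * f2
  have hd0 : d = 0 := by
    refine (mul_eq_zero.1 ?_).resolve_right (detPoly_ne_zero H G k)
    rw [← hD]
    linear_combination pPoly H G k * f2 - X * qPoly H G k * f1
  ext j
  rw [hvv]
  by_cases hj : (j : ℕ) < l
  · have := coeff_sum_C_mul_X_pow v' l j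
    rw [← ha, ha0, coeff_zero, if_pos hj] at this
    simpa using this.symm
  · have := coeff_sum_C_mul_X_pow (fun j => v' (l + j)) (k - l) (j - l)
    rw [← hd, hd0, coeff_zero, if_pos (by have := j.2; lia)] at this
    simp only [show l + (j - l) = (j : ℕ) by lia] at this
    simpa using this.symm

/-- Moving one column of the denominator matrix to the front. -/
lemma abs_det_updateCol_csv {k l : ℕ} {e : Fin (k + 1) → ℝ} (t : Fin (k + 1)) {l' : ℕ}
    (hl : (l' = l ∧ (t : ℕ) + 1 = l) ∨ (l' = l + 1 ∧ (t : ℕ) = k ∧ l ≤ k)) :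
    |((csv l 1 e ζ b c).updateCol t fun i => stieltjes ζ b c (e i)).det| =
      |(csv l' 0 e ζ b c).det| := by
  -- Replaced is the last μ̂-column if l' = l, the last power column if l' = l + 1; `Fin.cycleRange
  -- t` moves the new column to the front.
  have : (csv l 1 e ζ b c).updateCol t (fun i => stieltjes ζ b c (e i)) =
      (csv l' 0 e ζ b c).submatrix id (Fin.cycleRange t) := by
    ext i j
    rw [Matrix.submatrix_apply, Matrix.updateCol_apply]
    rcases lt_trichotomy j t with hj | hj | hj
    · have hc := Fin.coe_cycleRange_of_lt hj
      rw [if_neg hj.ne]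
      have hj' : (j : ℕ) < t := hj
      simp only [csv, Matrix.of_apply, hc, id]
      by_cases hjl : (j : ℕ) < l
      · rw [if_pos hjl, if_pos (by lia)]
        congr 2
        lia
      · rw [if_neg hjl, if_neg (by lia)]
        congr 1
        lia
    · subst hj
      simp only [if_true, Fin.cycleRange_self, csv, Matrix.of_apply, id]
      rw [if_pos (by simp; lia)]
      simp
    · have hc := Fin.cycleRange_of_gt hj
      rw [if_neg hj.ne', hc]
      have hj' : (t : ℕ) < j := hj
      have hjk := j.2
      simp only [csv, Matrix.of_apply, id]
      rw [if_neg (by lia), if_neg (by lia)]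
      congr 1
      lia
  rw [this, Matrix.det_permute', abs_mul]
  rcases Int.units_eq_one_or (Equiv.Perm.sign (Fin.cycleRange t)) with h | h <;> rw [h] <;> simp

/-- The ratio of the two Cauchy-Stieltjes-Vandermonde determinants is an alternating product. -/
lemma abs_det_csv_zero (hH : ∀ j, 0 < H j) (hG : ∀ j, 0 < G j)
    (h1 : ∀ i, (pPoly G H k).eval (e i) * stieltjes ζ b c (e i) = (qPoly H G k).eval (e i)) :
    |(csv ((k + 1) / 2) 0 e ζ b c).det| = altProd H G k * |(csv (k / 2) 1 e ζ b c).det| := by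
  rcases k with _ | k
  · simp [altProd]
  set l := (k + 1) / 2 with hl
  set A := csv l 1 e ζ b c with hA
  -- Since p(0) = 1, `h1` reads μ̂ = q - s μ̂ (p - 1)/s with p = `pPoly G H` and q = `qPoly H G`:
  -- the coefficients of -(p - 1)/s and q solve the system with right-hand side μ̂.
  set v : ℕ → ℝ := fun j => if j < l then -(pPoly G H (k + 1)).coeff (j + 1)
    else (qPoly H G (k + 1)).coeff (j - l) with hv
  have hAv : A.mulVec (fun j => v j) = fun i => stieltjes ζ b c (e i) := by
    ext i
    rw [hA, csv_mulVec (by lia)]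
    have e1 := eval_eq_sum_range' (n := l + 1)
      (Nat.lt_succ_of_le (natDegree_pPoly_le (h := G) (g := H) (k + 1))) (e i)
    have e2 := eval_eq_sum_range' (n := k + 1 - l)
      ((natDegree_qPoly_le (h := H) (g := G) (k + 1)).trans_lt (by lia)) (e i)
    rw [Finset.sum_range_succ', coeff_zero_eq_eval_zero, eval_zero_pPoly] at e1
    have s1 : ∑ j ∈ Finset.range l, v j * e i ^ j =
        -∑ j ∈ Finset.range l, (pPoly G H (k + 1)).coeff (j + 1) * e i ^ j := by
      rw [← Finset.sum_neg_distrib]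
      refine Finset.sum_congr rfl fun j hj => ?_
      rw [hv]
      simp only [if_pos (Finset.mem_range.1 hj)]
      ring
    have s2 : ∑ j ∈ Finset.range (k + 1 - l), v (l + j) * e i ^ j =
        (qPoly H G (k + 1)).eval (e i) := by
      rw [e2]
      refine Finset.sum_congr rfl fun j hj => ?_
      rw [hv]
      simp only [if_neg (show ¬(l + j < l) by lia), Nat.add_sub_cancel_left]
    have s3 : ∑ j ∈ Finset.range l, (pPoly G H (k + 1)).coeff (j + 1) * e i ^ (j + 1) =
        e i * ∑ j ∈ Finset.range l, (pPoly G H (k + 1)).coeff (j + 1) * e i ^ j := by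
      rw [Finset.mul_sum]
      exact Finset.sum_congr rfl fun j _ => by ring
    rw [s1, s2, ← h1, e1, s3]
    ring
  have hcramer : ∀ t, (A.updateCol t fun i => stieltjes ζ b c (e i)).det = A.det * v t := by
    intro t
    rw [← Matrix.cramer_apply, Matrix.cramer_eq_adjugate_mulVec, ← hAv, Matrix.mulVec_mulVec,
      Matrix.adjugate_mul, Matrix.smul_mulVec, Matrix.one_mulVec]
    rfl
  have hpos := altProd_pos hH hG (k := k + 1)
  -- The alternating product is the top coefficient of p for even size and of q for odd size; the
  -- matching column is replaced.
  rcases Nat.even_or_odd' (k + 1) with ⟨r, hr | hr⟩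
  · have hlr : l = r := by lia
    have ht : l - 1 < k + 1 := by lia
    have hvt : v (l - 1) = -altProd H G (k + 1) := by
      rw [hv]
      simp only [if_pos (show l - 1 < l by lia), show l - 1 + 1 = r by lia, hr,
        (coeff_bvp_top r).1]
    rw [← abs_det_updateCol_csv (l := l) ⟨l - 1, ht⟩ (Or.inl ⟨by lia, by simp only; lia⟩), ← hA,
      hcramer, hvt, abs_mul, abs_neg, abs_of_pos hpos, mul_comm]
  · have hlr : l = r := by lia
    have hvt : v k = altProd H G (k + 1) := by
      rw [hv]
      simp only [if_neg (show ¬(k < l) by lia), show k - l = r by lia, hr, (coeff_bvp_top r).2]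
    rw [← abs_det_updateCol_csv (l := l) ⟨k, by lia⟩ (Or.inr ⟨by lia, rfl, by lia⟩), ← hA,
      hcramer, hvt, abs_mul, abs_of_pos hpos, mul_comm]

end Determinant

/-- For distinct masses the determinantal formula gives the positions with the given spectral
data. -/
lemma FinSpectral.expPosition_eq {n : ℕ} {m x : Fin n → ℝ} {ζ b : Fin (n / 2) → ℝ} {c : ℝ}
    (hm : ∀ j, 0 < m j) (hinj : Function.Injective m) (h0 : ∀ j, 0 < ζ j)
    (h : FinSpectral m x ζ b c) (i : Fin n) : expPosition m ζ b c i = Real.exp (x i) := by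
  set hs := hSeq (extSeq 1 m) (extSeq 0 x) with hhs
  set gs := gSeq (extSeq 1 m) (extSeq 0 x) with hgs
  have hhpos : ∀ k, 0 < hs k := hSeq_pos (extSeq_one_pos hm) _
  have hgpos : ∀ k, 0 < gs k := gSeq_pos (extSeq_one_pos hm) _
  -- H and G list the coefficients from the right, as the nodes do.
  set H : ℕ → ℝ := fun j => hs (n - 1 - j) with hH
  set G : ℕ → ℝ := fun j => gs (n - 1 - j) with hG
  have hHpos : ∀ k, 0 < H k := fun k => hhpos _
  have hGpos : ∀ k, 0 < G k := fun k => hgpos _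
  have hnode : ∀ j (hj : j < n), node m ⟨j, hj⟩ = 1 / (H j * G j) := by
    intro j hj
    rw [hH, hG]
    simp only
    rw [hhs, hgs, hSeq_mul_gSeq, extSeq_of_lt 1 m (by lia), node]
    congr 3
    ext
    simp [Fin.rev]
    lia
  have hnodepos : ∀ j, 0 < node m j := fun j => by
    have := hm j.rev
    rw [node]
    positivity
  have hnodeinj : Function.Injective (node m) := by
    intro j j' hjj
    rw [node, node, one_div, one_div, inv_inj] at hjj
    have := (pow_left_inj₀ (hm _).le (hm _).le two_ne_zero).1 hjj
    exact Fin.rev_injective (hinj this)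
  -- interpolation conditions
  have hinterp : ∀ k (hk : k ≤ n) (j : Fin k),
      (pPoly G H k).eval (node m (Fin.castLE hk j)) *
        stieltjes ζ b c (node m (Fin.castLE hk j)) =
          (qPoly H G k).eval (node m (Fin.castLE hk j)) ∧
      node m (Fin.castLE hk j) * (qPoly G H k).eval (node m (Fin.castLE hk j)) *
        stieltjes ζ b c (node m (Fin.castLE hk j)) =
          (pPoly H G k).eval (node m (Fin.castLE hk j)) := by
    intro k hk j
    have he := hnodepos (Fin.castLE hk j)
    have heD : (detPoly H G k).eval (node m (Fin.castLE hk j)) = 0 := by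
      refine eval_detPoly_of_node j.2 ?_
      have := hnode j (j.2.trans_le hk)
      rw [show Fin.castLE hk j = ⟨j, j.2.trans_le hk⟩ from rfl, this]
      exact one_div_mul_cancel (mul_pos (hHpos _) (hGpos _)).ne'
    generalize node m (Fin.castLE hk j) = s at *
    obtain ⟨p1, p2⟩ := bvp_peel (h := hs) (g := gs) (H := H) (G := G) (n := n)
      (fun _ _ => rfl) (fun _ _ => rfl) hk
    have p1 := congrArg (eval s) p1
    have p2 := congrArg (eval s) p2
    have hP := eval_dataP_pos h0 he.le
    rw [hhs, hgs, h.1, h.2] at p1 p2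
    simp only [eval_sub, eval_mul, eval_X, heD, zero_mul, eval_dataQ _ _ h0 he.le] at p1 p2
    constructor
    · refine mul_left_cancel₀ hP.ne' ?_
      linarith
    · refine mul_left_cancel₀ hP.ne' ?_
      linarith
  have hratio : ∀ k (hk : k ≤ n), calD m ζ b c k hk ((k + 1) / 2) 0 =
      altProd H G k * calD m ζ b c k hk (k / 2) 1 ∧ 0 < calD m ζ b c k hk (k / 2) 1 := by
    intro k hk
    refine ⟨abs_det_csv_zero hHpos hGpos fun j => (hinterp k hk j).1, abs_pos.2 ?_⟩
    refine det_csv_one_ne_zero (fun a b hab => ?_)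
      (fun j => (hinterp k hk j).1) (fun j => (hinterp k hk j).2)
    exact Fin.castLE_injective hk (hnodeinj hab)
  obtain ⟨k, hk⟩ : ∃ k, n - (i : ℕ) = k + 1 := ⟨n - i - 1, by have := i.2; lia⟩
  have hkn : k + 1 ≤ n := by lia
  have hkn' : k ≤ n := by lia
  obtain ⟨r1, d1⟩ := hratio (k + 1) hkn
  obtain ⟨r2, d2⟩ := hratio k hkn'
  -- With floors, the two parities become one formula. The size N is kept general because the bounds
  -- on it are arguments of `calD`.
  have hform : expPosition m ζ b c i = ((∏ j : Fin k, node m (Fin.castLE hkn' j)) *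
      calD m ζ b c (k + 1) hkn ((k + 1 + 1) / 2) 0 * calD m ζ b c k hkn' ((k + 1) / 2) 0) /
      (m i * calD m ζ b c (k + 1) hkn ((k + 1) / 2) 1 * calD m ζ b c k hkn' (k / 2) 1) := by
    have gen : ∀ N (hN : N ≤ n) (hN' : N - 1 ≤ n), N = k + 1 →
        (if Odd N then
          ((∏ j : Fin (N - 1), node m (Fin.castLE hN' j)) *
            calD m ζ b c N hN ((N + 1) / 2) 0 * calD m ζ b c (N - 1) hN' ((N - 1) / 2) 0) /
          (m i * calD m ζ b c N hN ((N - 1) / 2) 1 * calD m ζ b c (N - 1) hN' ((N - 1) / 2) 1)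
        else
          ((∏ j : Fin (N - 1), node m (Fin.castLE hN' j)) *
            calD m ζ b c N hN (N / 2) 0 * calD m ζ b c (N - 1) hN' (N / 2) 0) /
          (m i * calD m ζ b c N hN (N / 2) 1 * calD m ζ b c (N - 1) hN' (N / 2 - 1) 1)) =
        ((∏ j : Fin k, node m (Fin.castLE hkn' j)) *
          calD m ζ b c (k + 1) hkn ((k + 1 + 1) / 2) 0 * calD m ζ b c k hkn' ((k + 1) / 2) 0) /
        (m i * calD m ζ b c (k + 1) hkn ((k + 1) / 2) 1 * calD m ζ b c k hkn' (k / 2) 1) := by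
      rintro N hN hN' rfl
      simp only [Nat.add_sub_cancel]
      split_ifs with hodd
      · obtain ⟨r, hr⟩ := hodd
        rw [show (k + 1) / 2 = k / 2 by lia]
        rfl
      · obtain ⟨r, hr⟩ := Nat.not_odd_iff_even.1 hodd
        rw [show (k + 1 + 1) / 2 = (k + 1) / 2 by lia, show (k + 1) / 2 - 1 = k / 2 by lia]
        rfl
    exact gen _ (Nat.sub_le n i) ((Nat.sub_le _ 1).trans (Nat.sub_le n i)) hk
  -- The node product cancels the two alternating products of length k; as `altProd H G (k + 1)` is
  -- `H k * altProd G H k`, only H_k / m_i remains.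
  have hprod : (∏ j : Fin k, node m (Fin.castLE hkn' j)) * (altProd H G k * altProd G H k) = 1 := by
    rw [altProd_mul_altProd, ← Fin.prod_univ_eq_prod_range (fun j => H j * G j),
      ← Finset.prod_mul_distrib]
    refine Finset.prod_eq_one fun j _ => ?_
    rw [show Fin.castLE hkn' j = ⟨j, j.2.trans_le hkn'⟩ from rfl, hnode]
    exact one_div_mul_cancel (mul_pos (hHpos _) (hGpos _)).ne'
  have hHk : H k = m i * Real.exp (x i) := by
    have : n - 1 - k = (i : ℕ) := by have := i.2; lia
    rw [hH]
    simp only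
    rw [this, hhs, hSeq, extSeq_coe, extSeq_coe]
  rw [hform, r1, r2, div_eq_iff (mul_pos (mul_pos (hm i) d1) d2).ne', altProd]
  linear_combination (H k * calD m ζ b c (k + 1) hkn ((k + 1) / 2) 1 *
    calD m ζ b c k hkn' (k / 2) 1) * hprod + (calD m ζ b c (k + 1) hkn ((k + 1) / 2) 1 *
    calD m ζ b c k hkn' (k / 2) 1) * hHk

/-! ### The positions given by the inverse formulas -/

lemma mem_closure_distinctMasses {n : ℕ} {m : Fin n → ℝ} (hm : ∀ j, 0 < m j) :
    m ∈ closure (distinctMasses n) := by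
  -- perturb in a direction with distinct entries
  have hlim : Tendsto (fun δ : ℝ => fun j : Fin n => m j + δ * (j : ℕ)) (𝓝[>] 0) (𝓝 m) := by
    have : Continuous (fun δ : ℝ => fun j : Fin n => m j + δ * (j : ℕ)) := by fun_prop
    have h := this.tendsto 0
    simp only [zero_mul, add_zero] at h
    exact h.mono_left nhdsWithin_le_nhds
  refine mem_closure_of_tendsto hlim ?_
  have hne : ∀ i j : Fin n, i ≠ j → ∀ᶠ δ in 𝓝[>] (0 : ℝ), m i + δ * (i : ℕ) ≠ m j + δ * (j : ℕ) := by
    intro i j hij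
    have hij' : ((i : ℕ) : ℝ) - (j : ℕ) ≠ 0 := by
      rw [sub_ne_zero]
      exact_mod_cast fun h => hij (Fin.ext h)
    by_cases hmm : m i = m j
    · filter_upwards [self_mem_nhdsWithin] with δ hδ h
      have : δ * (((i : ℕ) : ℝ) - (j : ℕ)) = 0 := by rw [hmm] at h; linarith
      exact mul_ne_zero (ne_of_gt hδ) hij' this
    · refine nhdsWithin_le_nhds ?_
      have hc : ContinuousAt (fun δ : ℝ => m i + δ * (i : ℕ) - (m j + δ * (j : ℕ))) 0 := by fun_prop
      filter_upwards [hc.eventually_ne (show _ ≠ (0 : ℝ) by simpa [sub_eq_zero] using hmm)] with δ hδ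
      exact sub_ne_zero.1 hδ
  have hall : ∀ᶠ δ in 𝓝[>] (0 : ℝ), ∀ i j : Fin n, i ≠ j →
      m i + δ * (i : ℕ) ≠ m j + δ * (j : ℕ) := by
    rw [eventually_all]
    intro i
    rw [eventually_all]
    intro j
    by_cases hij : i = j
    · simp [hij]
    · filter_upwards [hne i j hij] with δ hδ _ using hδ
  filter_upwards [hall, self_mem_nhdsWithin] with δ hδ hδ0
  have hδ0 : (0 : ℝ) < δ := hδ0
  refine ⟨fun j => add_pos_of_pos_of_nonneg (hm j) (by positivity), fun i j hij => ?_⟩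
  by_contra h
  exact hδ i j h hij

/-- At distinct masses the formula returns the solution of the inverse problem with the same p_n and
q_n, so continuity at fixed polynomials applies. -/
lemma FinSpectral.tendsto_log_expPosition {n : ℕ} {m x : Fin n → ℝ} {ζ b : Fin (n / 2) → ℝ} {c : ℝ}
    (hm : ∀ j, 0 < m j) (had : IsAdmissible n ζ b c) (h : FinSpectral m x ζ b c) (i : Fin n) :
    Tendsto (fun m' => Real.log (expPosition m' ζ b c i)) (𝓝[distinctMasses n] m) (𝓝 (x i)) := by
  have hex : ∀ m' : Fin n → ℝ, ∃ x' : Fin n → ℝ, (∀ j, 0 < m' j) → FinSpectral m' x' ζ b c := by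
    intro m'
    by_cases hm' : ∀ j, 0 < m' j
    · obtain ⟨x', hx'⟩ := exists_finSpectral hm' had
      exact ⟨x', fun _ => hx'⟩
    · exact ⟨0, fun h => absurd h hm'⟩
  choose x' hx' using hex
  have hmem : ∀ᶠ m' in 𝓝[distinctMasses n] m, m' ∈ distinctMasses n := self_mem_nhdsWithin
  have ht := tendsto_positions (l := 𝓝[distinctMasses n] m) (m := extSeq 1 m) (x := extSeq 0 x)
    (m' := fun m' => extSeq 1 m') (x' := fun m' => extSeq 0 (x' m')) (n := n)
    (extSeq_one_pos hm) (hmem.mono fun m' hm' => extSeq_one_pos hm'.1) (fun k hk => by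
      simp only [extSeq_of_lt 1 _ hk]
      exact ((continuous_apply _).tendsto m).mono_left nhdsWithin_le_nhds)
    (hmem.mono fun m' hm' => (hx' m' hm'.1).1.trans h.1.symm)
    (hmem.mono fun m' hm' => (hx' m' hm'.1).2.trans h.2.symm) i i.2
  simp only [extSeq_coe] at ht
  refine ht.congr' (hmem.mono fun m' hm' => ?_)
  beta_reduce
  rw [(hx' m' hm'.1).expPosition_eq hm'.1 hm'.2 had.eigenvalue_pos, Real.log_exp]

lemma FinSpectral.position_eq {n : ℕ} {m x : Fin n → ℝ} {ζ b : Fin (n / 2) → ℝ} {c : ℝ}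
    (hm : ∀ j, 0 < m j) (had : IsAdmissible n ζ b c) (h : FinSpectral m x ζ b c) :
    position m ζ b c = x := by
  ext i
  exact extendFrom_eq (mem_closure_distinctMasses hm) (h.tendsto_log_expPosition hm had i)

lemma finSpectral_position {n : ℕ} {m : Fin n → ℝ} {ζ b : Fin (n / 2) → ℝ} {c : ℝ}
    (hm : ∀ j, 0 < m j) (had : IsAdmissible n ζ b c) :
    FinSpectral m (position m ζ b c) ζ b c := by
  obtain ⟨x, hx⟩ := exists_finSpectral hm had
  rwa [hx.position_eq hm had]

/-! ### Time evolution -/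

/-- The peakon velocities `4 ∑_{i<k<j} h_i g_j + 2 h_k ∑_{j>k} g_j + 2 g_k ∑_{i<k} h_i`. -/
def speed (n : ℕ) (m x : ℕ → ℝ) (k : ℕ) : ℝ :=
  4 * (∑ j ∈ Finset.range k, hSeq m x j) * (∑ j ∈ Finset.Ico (k + 1) n, gSeq m x j) +
    2 * hSeq m x k * (∑ j ∈ Finset.Ico (k + 1) n, gSeq m x j) +
    2 * gSeq m x k * (∑ j ∈ Finset.range k, hSeq m x j)

/-- The time part of the Lax pair. -/
lemma hasDerivAt_eval_bvp {n : ℕ} {m : ℕ → ℝ} {x : ℝ → ℕ → ℝ} {t : ℝ}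
    (hx : ∀ k < n, HasDerivAt (fun τ => x τ k) (speed n m (x t) k) t) {s : ℝ} (hs : s ≠ 0)
    {k : ℕ} (hk : k ≤ n) :
    HasDerivAt (fun τ => (qPoly (hSeq m (x τ)) (gSeq m (x τ)) k).eval s)
      ((-2 / s + 2 * (∑ j ∈ Finset.range k, hSeq m (x t) j) *
          (∑ j ∈ Finset.Ico k n, gSeq m (x t) j)) *
          (qPoly (hSeq m (x t)) (gSeq m (x t)) k).eval s +
        2 / s * (∑ j ∈ Finset.range k, hSeq m (x t) j) *
          (pPoly (hSeq m (x t)) (gSeq m (x t)) k).eval s) t ∧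
    HasDerivAt (fun τ => (pPoly (hSeq m (x τ)) (gSeq m (x τ)) k).eval s)
      (2 * (∑ j ∈ Finset.Ico k n, gSeq m (x t) j) *
          (qPoly (hSeq m (x t)) (gSeq m (x t)) k).eval s -
        2 * (∑ j ∈ Finset.range k, hSeq m (x t) j) * (∑ j ∈ Finset.Ico k n, gSeq m (x t) j) *
          (pPoly (hSeq m (x t)) (gSeq m (x t)) k).eval s) t := by
  induction k with
  | zero =>
    simp only [qPoly_zero, pPoly_zero, eval_zero, eval_one, Finset.range_zero, Finset.sum_empty,
      mul_zero, zero_mul, add_zero, sub_zero]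
    exact ⟨hasDerivAt_const _ _, hasDerivAt_const _ _⟩
  | succ k ih =>
    obtain ⟨d1, d2⟩ := ih (by lia)
    have hxk := hx k (by lia)
    have dh : HasDerivAt (fun τ => hSeq m (x τ) k)
        (hSeq m (x t) k * speed n m (x t) k) t := by
      have := hxk.exp.const_mul (m k)
      rwa [← mul_assoc] at this
    have dg : HasDerivAt (fun τ => gSeq m (x τ) k)
        (-(gSeq m (x t) k * speed n m (x t) k)) t := by
      have := hxk.neg.exp.const_mul (m k)
      rw [← mul_assoc, mul_neg] at this
      exact this
    simp only [eval_qPoly_succ, eval_pPoly_succ]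
    -- Isolating g_k makes the formulas at k and k + 1 and the speed of particle k use the same
    -- partial sums.
    rw [Finset.sum_eq_sum_Ico_succ_bot (show k < n by lia)] at d1 d2
    rw [Finset.sum_range_succ]
    refine ⟨(d1.add (dh.mul d2)).congr_deriv ?_, (d2.add ((dg.const_mul s).mul d1)).congr_deriv ?_⟩
    · rw [speed]
      field_simp
      ring
    · rw [speed]
      field_simp
      ring

/-- The velocity field of the peakon system on configurations of `n` particles. -/
def speedField {n : ℕ} (m : Fin n → ℝ) (x : Fin n → ℝ) (i : Fin n) : ℝ :=
  speed n (extSeq 1 m) (extSeq 0 x) i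

/-- Regularity for the local existence of the flow. -/
lemma contDiff_speedField {n : ℕ} (m : Fin n → ℝ) : ContDiff ℝ 1 (speedField m) := by
  have hx : ∀ k, ContDiff ℝ 1 (fun x : Fin n → ℝ => extSeq 0 x k) := by
    intro k
    by_cases hk : k < n
    · simp only [extSeq_of_lt 0 _ hk]
      exact contDiff_apply ℝ ℝ _
    · simp only [extSeq, dif_neg hk]
      exact contDiff_const
  have hh : ∀ k, ContDiff ℝ 1 (fun x : Fin n → ℝ => hSeq (extSeq 1 m) (extSeq 0 x) k) := fun k =>
    contDiff_const.mul (hx k).exp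
  have hg : ∀ k, ContDiff ℝ 1 (fun x : Fin n → ℝ => gSeq (extSeq 1 m) (extSeq 0 x) k) := fun k =>
    contDiff_const.mul (hx k).neg.exp
  rw [contDiff_pi]
  intro i
  unfold speedField speed
  have hH := ContDiff.sum (s := Finset.range i) fun j _ => hh j
  have hG := ContDiff.sum (s := Finset.Ico ((i : ℕ) + 1) n) fun j _ => hg j
  exact (((contDiff_const.mul hH).mul hG).add ((contDiff_const.mul (hh i)).mul hG)).add
    ((contDiff_const.mul (hg i)).mul hH)

lemma eq_of_hasDerivAt_zero {f : ℝ → ℝ} {a b : ℝ}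
    (hf : ∀ t ∈ Set.Ioo a b, HasDerivAt f 0 t) {s t : ℝ} (hs : s ∈ Set.Ioo a b)
    (ht : t ∈ Set.Ioo a b) : f s = f t :=
  isOpen_Ioo.is_const_of_deriv_eq_zero isPreconnected_Ioo
    (fun _ hr => (hf _ hr).differentiableAt.differentiableWithinAt) (fun _ hr => (hf _ hr).deriv)
    hs ht

lemma weightAt_add {K : ℕ} (ζ b : Fin K → ℝ) (s t : ℝ) :
    weightAt ζ (weightAt ζ b s) (t - s) = weightAt ζ b t := by
  ext j
  rw [weightAt, weightAt, weightAt, mul_assoc, ← Real.exp_add]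
  congr 2
  ring

lemma hasDerivAt_weightAt {K : ℕ} (ζ b : Fin K → ℝ) (s t : ℝ) (j : Fin K) :
    HasDerivAt (fun τ => weightAt ζ b (τ - s) j) (2 / ζ j * weightAt ζ b (t - s) j) t := by
  have h1 : HasDerivAt (fun τ : ℝ => 2 * (τ - s) / ζ j) (2 / ζ j) t := by
    have := (((hasDerivAt_id t).sub_const s).const_mul 2).div_const (ζ j)
    simpa using this
  exact (h1.exp.const_mul (b j)).congr_deriv (by rw [weightAt]; ring)

/-- Along solutions of the peakon system the spectral data evolve linearly. -/
lemma FinSpectral.evolve {n : ℕ} {m : Fin n → ℝ} {ζ b : Fin (n / 2) → ℝ} {c : ℝ}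
    (hζ : Function.Injective ζ) (h0 : ∀ j, 0 < ζ j)
    {x : ℝ → Fin n → ℝ} {t₀ ε : ℝ} (hε : 0 < ε)
    (hx : ∀ t ∈ Set.Ioo (t₀ - ε) (t₀ + ε), HasDerivAt x (speedField m (x t)) t)
    (h : FinSpectral m (x t₀) ζ b c) {t : ℝ} (ht : t ∈ Set.Ioo (t₀ - ε) (t₀ + ε)) :
    FinSpectral m (x t) ζ (weightAt ζ b (t - t₀)) c := by
  have ht₀ : t₀ ∈ Set.Ioo (t₀ - ε) (t₀ + ε) := ⟨by linarith, by linarith⟩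
  have h0' : ∀ j, ζ j ≠ 0 := fun j => (h0 j).ne'
  set M := extSeq 1 m
  set Y : ℝ → ℕ → ℝ := fun τ => extSeq 0 (x τ) with hY
  set Q : ℝ → ℝ[X] := fun τ => qPoly (hSeq M (Y τ)) (gSeq M (Y τ)) n with hQ
  set P : ℝ → ℝ[X] := fun τ => pPoly (hSeq M (Y τ)) (gSeq M (Y τ)) n with hP
  -- At k = n the sums over g are empty. The Lax matrix has a pole at s = 0, where p is 1 in any
  -- case.
  have hder : ∀ τ ∈ Set.Ioo (t₀ - ε) (t₀ + ε), ∀ s : ℝ, s ≠ 0 →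
      HasDerivAt (fun τ => (Q τ).eval s)
        (-2 / s * ((Q τ).eval s - (Q τ).eval 0 * (P τ).eval s)) τ ∧
      HasDerivAt (fun τ => (P τ).eval s) 0 τ := by
    intro τ hτ s hs
    have hxk : ∀ k < n, HasDerivAt (fun σ => Y σ k) (speed n M (Y τ) k) τ := by
      intro k hk
      have := hasDerivAt_pi.1 (hx τ hτ) ⟨k, hk⟩
      simp only [hY, extSeq_of_lt 0 _ hk]
      exact this
    obtain ⟨d1, d2⟩ := hasDerivAt_eval_bvp hxk hs le_rfl
    simp only [Finset.Ico_self, Finset.sum_empty, mul_zero, zero_mul, sub_zero, add_zero] at d1 d2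
    refine ⟨d1.congr_deriv ?_, d2⟩
    rw [hQ, hP]
    simp only [eval_zero_qPoly]
    ring
  have hPc : ∀ τ ∈ Set.Ioo (t₀ - ε) (t₀ + ε), P τ = dataP ζ := by
    intro τ hτ
    rw [← h.2]
    refine Polynomial.funext fun s => ?_
    by_cases hs : s = 0
    · rw [hs, hP]
      simp only [eval_zero_pPoly]
    · exact eq_of_hasDerivAt_zero (fun σ hσ => (hder σ hσ s hs).2) hτ ht₀
  -- At s = -ζ_j the p-term vanishes, so q satisfies q̇ = (2/ζ_j) q.
  have hroot : ∀ τ ∈ Set.Ioo (t₀ - ε) (t₀ + ε), ∀ j,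
      (Q τ).eval (-ζ j) = weightAt ζ b (τ - t₀) j * (dataN ζ j).eval (-ζ j) := by
    intro τ hτ j
    have hd : ∀ σ ∈ Set.Ioo (t₀ - ε) (t₀ + ε), HasDerivAt
        (fun σ => (Q σ).eval (-ζ j) * Real.exp (-(2 * (σ - t₀) / ζ j))) 0 σ := by
      intro σ hσ
      have d1 := (hder σ hσ (-ζ j) (neg_ne_zero.2 (h0' j))).1
      rw [hPc σ hσ, eval_dataP_root] at d1
      have d2 : HasDerivAt (fun σ : ℝ => 2 * (σ - t₀) / ζ j) (2 / ζ j) σ := by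
        have := (((hasDerivAt_id σ).sub_const t₀).const_mul 2).div_const (ζ j)
        simpa using this
      refine (d1.mul d2.neg.exp).congr_deriv ?_
      have := h0' j
      field_simp
      ring
    have hc := eq_of_hasDerivAt_zero hd hτ ht₀
    have hQ0 : (Q t₀).eval (-ζ j) = b j * (dataN ζ j).eval (-ζ j) := by
      rw [← eval_dataQ_root b c, ← h.1]
    rw [hQ0, sub_self, mul_zero, zero_div, neg_zero, Real.exp_zero, mul_one, Real.exp_neg,
      ← div_eq_mul_inv, div_eq_iff (Real.exp_pos _).ne'] at hc
    rw [hc, weightAt]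
    ring
  have hdecomp : ∀ τ ∈ Set.Ioo (t₀ - ε) (t₀ + ε), ∃ κ,
      Q τ = dataQ ζ (weightAt ζ b (τ - t₀)) κ := by
    intro τ hτ
    have hdeg : (Q τ).natDegree ≤ n / 2 :=
      (natDegree_qPoly_le n).trans (Nat.div_le_div_right (Nat.sub_le _ _))
    refine ⟨(Q τ).coeff (n / 2) / (dataP ζ).coeff (n / 2), (eq_dataQ hζ h0' hdeg).trans ?_⟩
    congr 1
    ext j
    rw [hroot τ hτ, mul_div_cancel_right₀ _ (eval_dataN_self_ne_zero hζ h0' j)]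
  have hP1 := eval_dataP_pos h0 zero_le_one
  -- The shift κ recovered from the values at s = 1, where p is positive; this exhibits it as
  -- differentiable in time.
  set φ : ℝ → ℝ := fun τ => (Q τ).eval 1 / (dataP ζ).eval 1 -
    ∑ j, weightAt ζ b (τ - t₀) j / (1 + ζ j) with hφ
  have hφκ : ∀ τ κ, Q τ = dataQ ζ (weightAt ζ b (τ - t₀)) κ → φ τ = κ := by
    intro τ κ hκ
    rw [hφ]
    simp only
    rw [hκ, eval_dataQ _ _ h0 zero_le_one, mul_div_cancel_left₀ _ hP1.ne', stieltjes]
    ring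
  have hφ' : ∀ τ ∈ Set.Ioo (t₀ - ε) (t₀ + ε), HasDerivAt φ 0 τ := by
    intro τ hτ
    obtain ⟨κ, hκ⟩ := hdecomp τ hτ
    have d1 := (hder τ hτ 1 one_ne_zero).1
    rw [hPc τ hτ, hκ, eval_dataQ _ _ h0 zero_le_one, eval_zero_dataQ _ _ h0', stieltjes] at d1
    have d2 := HasDerivAt.fun_sum (u := Finset.univ) (fun j _ =>
      (hasDerivAt_weightAt ζ b t₀ τ j).div_const (1 + ζ j))
    refine ((d1.div_const ((dataP ζ).eval 1)).sub d2).congr_deriv ?_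
    have e1 : -2 / 1 * ((dataP ζ).eval 1 * (κ + ∑ j, weightAt ζ b (τ - t₀) j / (1 + ζ j)) -
        (κ + ∑ j, weightAt ζ b (τ - t₀) j / ζ j) * (dataP ζ).eval 1) / (dataP ζ).eval 1 =
        ∑ j, -2 * (weightAt ζ b (τ - t₀) j / (1 + ζ j) - weightAt ζ b (τ - t₀) j / ζ j) := by
      rw [← Finset.mul_sum, Finset.sum_sub_distrib]
      field_simp
      ring
    rw [e1, ← Finset.sum_sub_distrib]
    refine Finset.sum_eq_zero fun j _ => ?_
    have h1 := h0' j
    have h2 : 1 + ζ j ≠ 0 := by have := h0 j; positivity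
    field_simp
    ring
  obtain ⟨κ, hκ⟩ := hdecomp t ht
  have hκc : κ = c := by
    have hw : weightAt ζ b (t₀ - t₀) = b := by ext j; simp [weightAt]
    rw [← hφκ t κ hκ, ← hφκ t₀ c (by rw [hw]; exact h.1)]
    exact eq_of_hasDerivAt_zero hφ' ht ht₀
  exact ⟨hκc ▸ hκ, hPc t ht⟩

lemma IsAdmissible.weightAt {n : ℕ} {ζ b : Fin (n / 2) → ℝ} {c : ℝ} (h : IsAdmissible n ζ b c)
    (t : ℝ) : IsAdmissible n ζ (weightAt ζ b t) c :=
  ⟨h.strictMono, h.eigenvalue_pos, fun j => mul_pos (h.weight_pos j) (Real.exp_pos _),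
    h.shift_even, h.shift_odd⟩

/-- The positions given by the inverse formulas solve the peakon system, ordered or not. -/
lemma hasDerivAt_positionAt {n : ℕ} {m : Fin n → ℝ} (hm : ∀ j, 0 < m j) {ζ b : Fin (n / 2) → ℝ}
    {c : ℝ} (had : IsAdmissible n ζ b c) (t : ℝ) :
    HasDerivAt (positionAt m ζ b c) (speedField m (positionAt m ζ b c t)) t := by
  -- The flow is started from the formulas at time t. Its spectral data evolve as prescribed, so by
  -- uniqueness it agrees with the formulas near t.
  obtain ⟨x, hx0, ε, hε, hx⟩ := (contDiff_speedField m).contDiffAt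
    |>.exists_forall_mem_closedBall_exists_eq_forall_mem_Ioo_hasDerivAt₀ (x₀ := positionAt m ζ b c t) t
  have ht : t ∈ Set.Ioo (t - ε) (t + ε) := ⟨by linarith, by linarith⟩
  have hs : FinSpectral m (x t) ζ (MCH.weightAt ζ b t) c := by
    rw [hx0]
    exact finSpectral_position hm (had.weightAt t)
  have heq : ∀ τ ∈ Set.Ioo (t - ε) (t + ε), x τ = positionAt m ζ b c τ := by
    intro τ hτ
    have h1 := hs.evolve had.strictMono.injective had.eigenvalue_pos hε hx hτ
    rw [weightAt_add] at h1
    exact h1.unique hm (finSpectral_position hm (had.weightAt τ))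
  have hd := hx t ht
  rw [hx0] at hd
  refine hd.congr_of_eventuallyEq ?_
  filter_upwards [isOpen_Ioo.mem_nhds ht] with τ hτ using (heq τ hτ).symm

/-! ### The multipeakon profile -/

section Profile

variable {n : ℕ} (m x : Fin n → ℝ)

lemma continuous_multipeakon : Continuous (multipeakon m x) := by
  unfold multipeakon
  fun_prop

lemma hasDerivAt_exp_neg_abs {a y : ℝ} (hy : y ≠ a) :
    HasDerivAt (fun w => Real.exp (-|w - a|))
      ((if a < y then -1 else 1) * Real.exp (-|y - a|)) y := by
  have h1 : HasDerivAt (fun w : ℝ => w - a) 1 y := (hasDerivAt_id y).sub_const a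
  rcases lt_or_gt_of_ne hy with h | h
  · rw [if_neg h.not_gt]
    refine (((hasDerivAt_abs_neg (sub_neg.2 h)).comp y h1).neg.exp).congr_deriv ?_
    simp
  · rw [if_pos h]
    refine (((hasDerivAt_abs_pos (sub_pos.2 h)).comp y h1).neg.exp).congr_deriv ?_
    simp

lemma deriv_multipeakon {y : ℝ} (hy : ∀ j, y ≠ x j) :
    deriv (multipeakon m x) y =
      ∑ j, m j * (if x j < y then -1 else 1) * Real.exp (-|y - x j|) := by
  have := HasDerivAt.fun_sum (u := Finset.univ) fun j _ =>
    (hasDerivAt_exp_neg_abs (hy j)).const_mul (m j)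
  simp only [← mul_assoc] at this
  exact this.deriv

/-- Just left of y the signs are frozen, a peak at y counting as lying to the right. -/
lemma tendsto_deriv_multipeakon_left (y : ℝ) :
    Tendsto (deriv (multipeakon m x)) (𝓝[<] y)
      (𝓝 (∑ j, m j * (if x j < y then -1 else 1) * Real.exp (-|y - x j|))) := by
  have hcont : Continuous (fun w : ℝ => ∑ j, m j * (if x j < y then -1 else 1) *
      Real.exp (-|w - x j|)) := by fun_prop
  refine ((hcont.tendsto y).mono_left nhdsWithin_le_nhds).congr' ?_
  have hev : ∀ᶠ w in 𝓝[<] y, ∀ j, w ≠ x j ∧ (x j < w ↔ x j < y) := by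
    rw [eventually_all]
    intro j
    by_cases h : x j < y
    · filter_upwards [nhdsWithin_le_nhds (lt_mem_nhds h)] with w hw
      exact ⟨(ne_of_gt hw), iff_of_true hw h⟩
    · filter_upwards [self_mem_nhdsWithin] with w hw
      have hwx : w < x j := lt_of_lt_of_le hw (not_lt.1 h)
      exact ⟨hwx.ne, iff_of_false hwx.not_gt h⟩
  filter_upwards [hev] with w hw
  rw [deriv_multipeakon m x fun j => (hw j).1]
  simp only [(hw _).2]

lemma tendsto_deriv_multipeakon_right (y : ℝ) :
    Tendsto (deriv (multipeakon m x)) (𝓝[>] y)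
      (𝓝 (∑ j, m j * (if x j ≤ y then -1 else 1) * Real.exp (-|y - x j|))) := by
  have hcont : Continuous (fun w : ℝ => ∑ j, m j * (if x j ≤ y then -1 else 1) *
      Real.exp (-|w - x j|)) := by fun_prop
  refine ((hcont.tendsto y).mono_left nhdsWithin_le_nhds).congr' ?_
  have hev : ∀ᶠ w in 𝓝[>] y, ∀ j, w ≠ x j ∧ (x j < w ↔ x j ≤ y) := by
    rw [eventually_all]
    intro j
    by_cases h : x j ≤ y
    · filter_upwards [self_mem_nhdsWithin] with w hw
      have hwx : x j < w := lt_of_le_of_lt h hw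
      exact ⟨hwx.ne', iff_of_true hwx h⟩
    · filter_upwards [nhdsWithin_le_nhds (gt_mem_nhds (not_le.1 h))] with w hw
      exact ⟨ne_of_lt hw, iff_of_false (not_lt.2 (le_of_lt hw)) h⟩
  filter_upwards [hev] with w hw
  rw [deriv_multipeakon m x fun j => (hw j).1]
  simp only [(hw _).2]

/-- Splitting a weighted sum of exponentials at the `i`-th peak. -/
lemma sum_exp_split {x : Fin n → ℝ} (hx : StrictMono x) (i : Fin n) (σ : Fin n → ℝ) {a b c : ℝ}
    (ha : ∀ j < i, σ j = a) (hb : σ i = b) (hc : ∀ j, i < j → σ j = c) :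
    ∑ j, m j * σ j * Real.exp (-|x i - x j|) =
      a * (Real.exp (-x i) * ∑ j ∈ Finset.range i, hSeq (extSeq 1 m) (extSeq 0 x) j) + b * m i +
      c * (Real.exp (x i) * ∑ j ∈ Finset.Ico ((i : ℕ) + 1) n, gSeq (extSeq 1 m) (extSeq 0 x) j) := by
  set F : ℕ → ℝ := extSeq 0 fun j => m j * σ j * Real.exp (-|x i - x j|) with hF
  have h1 : ∑ j, m j * σ j * Real.exp (-|x i - x j|) = ∑ j ∈ Finset.range n, F j := by
    rw [← Fin.sum_univ_eq_sum_range F]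
    simp [hF]
  rw [h1, ← Finset.sum_range_add_sum_Ico F i.2.le, Finset.sum_eq_sum_Ico_succ_bot i.2]
  have hi : F i = b * m i := by
    rw [hF, extSeq_coe, hb]
    simp [mul_comm]
  have hL : ∑ j ∈ Finset.range i, F j =
      a * (Real.exp (-x i) * ∑ j ∈ Finset.range i, hSeq (extSeq 1 m) (extSeq 0 x) j) := by
    rw [Finset.mul_sum, Finset.mul_sum]
    refine Finset.sum_congr rfl fun j hj => ?_
    have hji : j < i := Finset.mem_range.1 hj
    have hjn : j < n := hji.trans i.2
    have hlt : (⟨j, hjn⟩ : Fin n) < i := hji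
    rw [hF, hSeq, extSeq_of_lt _ _ hjn, extSeq_of_lt _ _ hjn, extSeq_of_lt _ _ hjn, ha _ hlt,
      abs_of_pos (sub_pos.2 (hx hlt)), neg_sub, sub_eq_add_neg, Real.exp_add]
    ring
  have hR : ∑ j ∈ Finset.Ico ((i : ℕ) + 1) n, F j =
      c * (Real.exp (x i) * ∑ j ∈ Finset.Ico ((i : ℕ) + 1) n,
        gSeq (extSeq 1 m) (extSeq 0 x) j) := by
    rw [Finset.mul_sum, Finset.mul_sum]
    refine Finset.sum_congr rfl fun j hj => ?_
    obtain ⟨hij, hjn⟩ := Finset.mem_Ico.1 hj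
    have hlt : i < (⟨j, hjn⟩ : Fin n) := by
      rw [Fin.lt_def]
      exact hij
    rw [hF, gSeq, extSeq_of_lt _ _ hjn, extSeq_of_lt _ _ hjn, extSeq_of_lt _ _ hjn, hc _ hlt,
      abs_of_neg (sub_neg.2 (hx hlt)), neg_neg, sub_eq_add_neg, Real.exp_add]
    ring
  rw [hL, hi, hR]
  ring

/-- With α and β the contributions of the peaks to the left and right, u = α + m_i + β and u_x = β -
α ± m_i on the two sides, so u² - ⟨u_x²⟩ = 4αβ + 2m_i(α + β). -/
lemma velocity_multipeakon {x : Fin n → ℝ} (hx : StrictMono x) (i : Fin n) :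
    velocity (multipeakon m x) (x i) = speedField m x i := by
  have hl := leftLim_eq_of_tendsto ((tendsto_deriv_multipeakon_left m x (x i)).pow 2)
  have hr := rightLim_eq_of_tendsto ((tendsto_deriv_multipeakon_right m x (x i)).pow 2)
  have hu : multipeakon m x (x i) = ∑ j, m j * 1 * Real.exp (-|x i - x j|) := by
    simp [multipeakon]
  rw [velocity, avg, hl, hr, hu,
    sum_exp_split m hx i (fun _ => 1) (fun _ _ => rfl) rfl (fun _ _ => rfl),
    sum_exp_split m hx i (fun j => if x j < x i then -1 else 1) (a := -1) (b := 1) (c := 1)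
      (fun j hj => if_pos (hx hj)) (if_neg (lt_irrefl _)) (fun j hj => if_neg (hx hj).not_gt),
    sum_exp_split m hx i (fun j => if x j ≤ x i then -1 else 1) (a := -1) (b := -1) (c := 1)
      (fun j hj => if_pos (hx hj).le) (if_pos le_rfl) (fun j hj => if_neg (hx hj).not_ge),
    speedField, speed, hSeq, gSeq, extSeq_coe, extSeq_coe]
  have hexp : Real.exp (x i) * Real.exp (-x i) = 1 := by rw [← Real.exp_add]; simp
  generalize ∑ j ∈ Finset.range i, hSeq (extSeq 1 m) (extSeq 0 x) j = A
  generalize ∑ j ∈ Finset.Ico ((i : ℕ) + 1) n, gSeq (extSeq 1 m) (extSeq 0 x) j = B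
  linear_combination (4 * A * B) * hexp

/-- `exp(-|y - a|)` is twice the Green function of `1 - ∂²`. -/
lemma integral_exp_neg_abs_mul {φ : ℝ → ℝ} (hφ : ContDiff ℝ ∞ φ) (hc : HasCompactSupport φ)
    (a : ℝ) :
    Integrable (fun y => Real.exp (-|y - a|) * (φ y - deriv (deriv φ) y)) ∧
      ∫ y, Real.exp (-|y - a|) * (φ y - deriv (deriv φ) y) = 2 * φ a := by
  have hφ1 : ContDiff ℝ ∞ (deriv φ) := (contDiff_infty_iff_deriv.1 hφ).2
  have hφ2 : ContDiff ℝ ∞ (deriv (deriv φ)) := (contDiff_infty_iff_deriv.1 hφ1).2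
  have hd : ∀ y, HasDerivAt φ (deriv φ y) y := fun y =>
    (hφ.differentiable (by simp) y).hasDerivAt
  have hd1 : ∀ y, HasDerivAt (deriv φ) (deriv (deriv φ) y) y := fun y =>
    (hφ1.differentiable (by simp) y).hasDerivAt
  have hinterp : Integrable (fun y => Real.exp (-|y - a|) * (φ y - deriv (deriv φ) y)) := by
    refine Continuous.integrable_of_hasCompactSupport ?_ ?_
    · have := hφ.continuous
      have := hφ2.continuous
      fun_prop
    · exact (hc.sub hc.deriv.deriv).mul_left
  refine ⟨hinterp, ?_⟩
  rw [← integral_add_compl measurableSet_Ioi hinterp (s := Set.Ioi a), Set.compl_Ioi]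
  -- Explicit antiderivatives on the two half-lines; in the sum of the boundary values at a, the
  -- φ'-terms cancel.
  have h1 : ∀ y, HasDerivAt (fun y => -(Real.exp (-(y - a)) * (φ y + deriv φ y)))
      (Real.exp (-(y - a)) * (φ y - deriv (deriv φ) y)) y := fun y => by
    have := ((((hasDerivAt_id y).sub_const a).neg.exp).mul ((hd y).add (hd1 y))).neg
    refine this.congr_deriv ?_
    simp
    ring
  have h2 : ∀ y, HasDerivAt (fun y => Real.exp (y - a) * (φ y - deriv φ y))
      (Real.exp (y - a) * (φ y - deriv (deriv φ) y)) y := fun y => by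
    have := (((hasDerivAt_id y).sub_const a).exp).mul ((hd y).sub (hd1 y))
    refine this.congr_deriv ?_
    simp
    ring
  have i1 : ∫ y in Set.Ioi a, Real.exp (-|y - a|) * (φ y - deriv (deriv φ) y) =
      φ a + deriv φ a := by
    have hcd : ContDiff ℝ 1 (fun y => -(Real.exp (-(y - a)) * (φ y + deriv φ y))) :=
      ((contDiff_id.sub contDiff_const).neg.exp.mul ((hφ.add hφ1).of_le (by simp))).neg
    have hcs : HasCompactSupport (fun y => -(Real.exp (-(y - a)) * (φ y + deriv φ y))) :=
      ((hc.add hc.deriv).mul_left).neg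
    have := hcs.integral_Ioi_deriv_eq hcd a
    rw [sub_self, neg_zero, Real.exp_zero, one_mul, neg_neg] at this
    rw [← this]
    refine setIntegral_congr_fun measurableSet_Ioi fun y hy => ?_
    have hy' : 0 < y - a := sub_pos.2 hy
    simp only [(h1 y).deriv, abs_of_pos hy']
  have i2 : ∫ y in Set.Iic a, Real.exp (-|y - a|) * (φ y - deriv (deriv φ) y) =
      φ a - deriv φ a := by
    have hcd : ContDiff ℝ 1 (fun y => Real.exp (y - a) * (φ y - deriv φ y)) :=
      (contDiff_id.sub contDiff_const).exp.mul ((hφ.sub hφ1).of_le (by simp))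
    have hcs : HasCompactSupport (fun y => Real.exp (y - a) * (φ y - deriv φ y)) :=
      (hc.sub hc.deriv).mul_left
    have := hcs.integral_Iic_deriv_eq hcd a
    rw [sub_self, Real.exp_zero, one_mul] at this
    rw [← this]
    refine setIntegral_congr_fun measurableSet_Iic fun y hy => ?_
    have hy' : y - a ≤ 0 := sub_nonpos.2 hy
    simp only [(h2 y).deriv, abs_of_nonpos hy', neg_neg]
  rw [i1, i2]
  ring

/-- The measure `u - u_xx = ∑ 2 m_j δ_{x_j}`. -/
def peakonMeasure : Measure ℝ :=
  ∑ j, ENNReal.ofReal (2 * m j) • Measure.dirac (x j)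

lemma isFiniteMeasure_peakonMeasure : IsFiniteMeasure (peakonMeasure m x) := by
  refine ⟨?_⟩
  rw [peakonMeasure, Measure.finsetSum_apply]
  exact ENNReal.sum_lt_top.2 fun j _ => by simp [ENNReal.mul_lt_top]

/-- Every function is integrable against finitely many Dirac masses, so no measurability of the
velocity is required. -/
lemma integrable_peakonMeasure (f : ℝ → ℝ) : Integrable f (peakonMeasure m x) := by
  rw [peakonMeasure, integrable_finsetSum_measure]
  exact fun j _ => (integrable_dirac (by simp)).smul_measure ENNReal.ofReal_ne_top

lemma integral_peakonMeasure {m : Fin n → ℝ} (hm : ∀ j, 0 < m j) (x : Fin n → ℝ) (f : ℝ → ℝ) :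
    ∫ y, f y ∂(peakonMeasure m x) = ∑ j, 2 * m j * f (x j) := by
  rw [peakonMeasure, integral_finsetSum_measure
    fun j _ => (integrable_dirac (by simp)).smul_measure ENNReal.ofReal_ne_top]
  refine Finset.sum_congr rfl fun j _ => ?_
  rw [integral_smul_measure, integral_dirac, ENNReal.toReal_ofReal (by have := hm j; positivity),
    smul_eq_mul]

lemma integral_multipeakon_mul {m : Fin n → ℝ} (hm : ∀ j, 0 < m j) (x : Fin n → ℝ) {φ : ℝ → ℝ}
    (hφ : ContDiff ℝ ∞ φ) (hc : HasCompactSupport φ) :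
    ∫ y, multipeakon m x y * (φ y - deriv (deriv φ) y) = ∫ y, φ y ∂(peakonMeasure m x) := by
  rw [integral_peakonMeasure hm]
  simp only [multipeakon, Finset.sum_mul, mul_assoc]
  rw [integral_finsetSum _ fun j _ => ((integral_exp_neg_abs_mul hφ hc (x j)).1).const_mul _]
  refine Finset.sum_congr rfl fun j _ => ?_
  rw [integral_const_mul, (integral_exp_neg_abs_mul hφ hc (x j)).2]
  ring

end Profile

/-- Ordered solutions of the peakon system give solutions of the regularized equation. -/
lemma isRegularizedSolution_of_hasDerivAt {n : ℕ} {m : Fin n → ℝ} (hm : ∀ j, 0 < m j)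
    {x : ℝ → Fin n → ℝ} (hx : ∀ t, HasDerivAt x (speedField m (x t)) t) :
    IsRegularizedSolution (fun t => multipeakon m (x t)) {t | StrictMono (x t)} := by
  have hcont : ∀ i, Continuous fun t => x t i := fun i =>
    continuous_iff_continuousAt.2 fun t => (hasDerivAt_pi.1 (hx t) i).continuousAt
  refine ⟨?_, fun t => peakonMeasure m (x t), fun t ht => ⟨?_, continuous_multipeakon m _, fun y =>
    ⟨⟨_, tendsto_deriv_multipeakon_left m _ y⟩, ⟨_, tendsto_deriv_multipeakon_right m _ y⟩⟩,
    fun φ hφ hc => ⟨integral_multipeakon_mul hm _ hφ hc, integrable_peakonMeasure m _ _, ?_⟩⟩⟩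
  · have : {t | StrictMono (x t)} = ⋂ i, ⋂ j, {t | i < j → x t i < x t j} := by
      ext t
      simp [StrictMono]
    rw [this]
    refine isOpen_iInter_of_finite fun i => isOpen_iInter_of_finite fun j => ?_
    by_cases hij : i < j
    · simpa [hij] using isOpen_lt (hcont i) (hcont j)
    · simp [hij]
  · have := isFiniteMeasure_peakonMeasure m (x t)
    infer_instance
  · simp only [integral_peakonMeasure hm]
    refine HasDerivAt.fun_sum fun j _ => HasDerivAt.const_mul _ ?_
    -- The ordering at time t enters here.
    rw [velocity_multipeakon m ht, mul_comm]
    exact ((hφ.differentiable (by simp) _).hasDerivAt).comp t (hasDerivAt_pi.1 (hx t) j)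

end MCH

end

theorem theorem5p1 (n : ℕ) (m : Fin n → ℝ) (hm : ∀ j, 0 < m j) :
    -- arbitrary admissible spectral data produce a multipeakon solution
    (∀ (ζ b : Fin (n / 2) → ℝ) (c : ℝ), MCH.IsAdmissible n ζ b c →
      -- the positions are given by the inverse formulas (literally, if the masses are distinct)
      (Function.Injective m → ∀ (t : ℝ) (i : Fin n),
        0 < MCH.expPosition m ζ (MCH.weightAt ζ b t) c i ∧
        MCH.positionAt m ζ b c t i
          = Real.log (MCH.expPosition m ζ (MCH.weightAt ζ b t) c i)) ∧
      -- and by their continuous extension in general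
      (∀ (t : ℝ) (i : Fin n),
        Filter.Tendsto
          (fun m' => Real.log (MCH.expPosition m' ζ (MCH.weightAt ζ b t) c i))
          (nhdsWithin m (MCH.distinctMasses n)) (nhds (MCH.positionAt m ζ b c t i))) ∧
      -- the eigenvalues and the shift are constant, the weights are `b_j exp(2t / ζ_j)`
      (∀ t : ℝ, MCH.HasSpectralData m (MCH.positionAt m ζ b c t) ζ (MCH.weightAt ζ b t) c) ∧
      -- as long as the positions are ordered, they obey the peakon equations of motion
      (∀ t ∈ {t : ℝ | StrictMono (MCH.positionAt m ζ b c t)}, ∀ i : Fin n,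
        HasDerivAt (fun s => MCH.positionAt m ζ b c s i)
          (MCH.velocity (MCH.multipeakon m (MCH.positionAt m ζ b c t))
            (MCH.positionAt m ζ b c t i)) t) ∧
      -- and `u` solves the regularized equation on that open set of times
      MCH.IsRegularizedSolution
        (fun t => MCH.multipeakon m (MCH.positionAt m ζ b c t))
        {t : ℝ | StrictMono (MCH.positionAt m ζ b c t)}) ∧
    -- every ordered initial configuration is attained at time zero by such a solution
    (∀ x₀ : Fin n → ℝ, StrictMono x₀ →
      ∃ (ζ b : Fin (n / 2) → ℝ) (c : ℝ), MCH.IsAdmissible n ζ b c ∧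
        MCH.positionAt m ζ b c 0 = x₀) := by
  refine ⟨fun ζ b c had => ⟨fun hinj t i => ?_, fun t i => ?_, fun t => ?_, fun t ht i => ?_, ?_⟩,
    fun x₀ _ => ?_⟩
  · have h := MCH.finSpectral_position hm (had.weightAt t)
    rw [h.expPosition_eq hm hinj had.eigenvalue_pos, Real.log_exp]
    exact ⟨Real.exp_pos _, rfl⟩
  · exact (MCH.finSpectral_position hm (had.weightAt t)).tendsto_log_expPosition hm
      (had.weightAt t) i
  · exact (MCH.finSpectral_position hm (had.weightAt t)).hasSpectralData had.eigenvalue_pos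
  · rw [MCH.velocity_multipeakon m ht]
    exact hasDerivAt_pi.1 (MCH.hasDerivAt_positionAt hm had t) i
  · exact MCH.isRegularizedSolution_of_hasDerivAt hm (MCH.hasDerivAt_positionAt hm had)
  -- The data are those of the initial configuration; uniqueness in the inverse problem makes the
  -- formulas return it.
  · obtain ⟨ζ, b, c, had, h⟩ :=
      MCH.exists_spectralPoly n (MCH.extSeq_one_pos hm) (MCH.extSeq 0 x₀)
    refine ⟨ζ, b, c, had, ?_⟩
    have hw : MCH.weightAt ζ b 0 = b := by ext j; simp [MCH.weightAt]
    rw [MCH.positionAt, hw]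
    exact MCH.FinSpectral.position_eq hm had h
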